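/- Let $n\ge 0$, let $\wp$ be the Weierstrass function of a lattice $\Lambda\subset\mathbb C$, let $a\in\mathbb C$, and let $\lambda_1,\dots,\lambda_n\in\mathbb C$ satisfy $\lambda_{ij}:=\lambda_i-\lambda_j\notin\Lambda$ for $i\ne j$. Let $\mathcal M$ be the algebra of meromorphic functions on $\mathbb C^n$ (coordinates $x_1,\dots,x_n$), let $s_{ij}$ exchange the $i$-th and $j$-th coordinates, and write $x_{ij}=x_i-x_j$. Put $$\psi_{ij}(z)=\frac{a^2}{z^2}-\bigl(\wp(z)-\wp(\lambda_{ij})\bigr).$$ Let $\tilde{\mathcal E}_n(\psi_{ij})$ be the $\mathbb C$-algebra generated by the algebra $\mathcal M$ and symbols $\langle ij\rangle=-\langle ji\rangle$ ($1\le i,j\le n$, $i\neq j$), subject to the following relations for $i,j,k$ distinct: (i) $\langle ij\rangle^2=\psi_{ij}(x_{ij})$; (ii) $\langle ij\rangle\langle kl\rangle=\langle kl\rangle\langle ij\rangle$ if $k\ne l$ and $\{i,j\}\cap\{k,l\}=\emptyset$; (iii) $\langle ij\rangle\langle jk\rangle+\langle jk\rangle\langle ki\rangle+\langle ki\rangle\langle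 ij\rangle=0$; (iv) $\bigl(\langle ij\rangle-\tfrac{a}{x_{ij}}\bigr)f(\xi)=f(s_{ij}\xi)\bigl(\langle ij\rangle-\tfrac{a}{x_{ij}}\bigr)$ for $f\in\mathcal M$. Put $[ij]=\langle ij\rangle-\frac{a}{x_{ij}}$, so that $[ij]^2=-(\wp(x_{ij})-\wp(\lambda_{ij}))$, and define the Dunkl elements $\theta_i=\sum_{j\ne i}[ij]$. Define polynomials $E_k(I)=E_k(X_i\mid i\in I)\in\mathbb C[X_1,\dots,X_n]$ for $k\ge 0$ and $I\subset\{1,\dots,n\}$ by $E_0(I)=1$, $E_k(\emptyset)=0$ for $k\ge1$, and, for $j\notin I$ and $k\geq 1$, $$E_k(I\cup\{j\})=E_k(I)+E_{k-1}(I)X_j+\sum_{i\in I}\wp(\lambda_{ij})E_{k-2}(I\setminus\{i\}),$$ where $E_{-1}=0$. For $I_0\subset\{1,\dots,n\}$ with $\#I_0=2l$ put $$\phi(I_0)=\sum\prod_{i=1}^{l}\wp(x_{a_ib_i})\in\mathcal M,$$ the sum being over all $(a_i,b_i)_{1\le i\le l}$ with $I_0=\{a_1,\dots,a_l,b_1,\dots,b_l\}$,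 $a_1<\dots<a_l$ and $a_i<b_i$. **Theorem 3.1.** The Dunkl elements commute pairwise, so that polynomials can be evaluated at them, and for all $k\ge0$ and $I\subset\{1,\dots,n\}$ one has in $\tilde{\mathcal E}_n(\psi_{ij})$ $$E_k(\theta_i\mid i\in I)=\sum_{l=0}^{\lfloor k/2\rfloor}\ \sum_{I_0\subset I,\ \#I_0=2l}\phi(I_0)\sum_{(*)}[a_1b_1]\cdots[a_{k-2l}b_{k-2l}],$$ where $(*)$ means the sum over all sequences of pairs $(a_1,b_1),\dots,(a_{k-2l},b_{k-2l})$ with $a_i\in I\setminus I_0$, $b_i\notin I$, $a_1,\dots,a_{k-2l}$ distinct and $b_1\le\dots\le b_{k-2l}$. -/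

import Mathlib

open Filter Topology

noncomputable section

namespace EllipticFK

/-! ### Meromorphic functions on `ℂⁿ` -/

/-- `f : ℂⁿ → ℂ` is (a representative of) a meromorphic function: near every point it is a quotient
`g / h` of holomorphic functions with `h` not identically zero, wherever `h` does not vanish. The
values of `f` on the zero set of `h` are irrelevant. -/
def IsMero {n : ℕ} (f : (Fin n → ℂ) → ℂ) : Prop :=
  ∀ p, ∃ g h : (Fin n → ℂ) → ℂ, AnalyticAt ℂ g p ∧ AnalyticAt ℂ h p ∧
    (∃ᶠ z in 𝓝 p, h z ≠ 0) ∧ ∀ᶠ z in 𝓝 p, h z ≠ 0 → f z = g z / h z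

/-- A product of two nonzero germs of holomorphic functions is nonzero. -/
lemma frequently_mul_ne_zero {n : ℕ} {p : Fin n → ℂ} {h₁ h₂ : (Fin n → ℂ) → ℂ}
    (a₁ : AnalyticAt ℂ h₁ p) (a₂ : AnalyticAt ℂ h₂ p)
    (f₁ : ∃ᶠ z in 𝓝 p, h₁ z ≠ 0) (f₂ : ∃ᶠ z in 𝓝 p, h₂ z ≠ 0) :
    ∃ᶠ z in 𝓝 p, h₁ z * h₂ z ≠ 0 := by
  intro hz
  have hz' : ∀ᶠ z in 𝓝 p, h₁ z * h₂ z = 0 := hz.mono fun z h => not_not.1 h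
  obtain ⟨r, hr, hball⟩ := Metric.eventually_nhds_iff_ball.1
    ((a₁.eventually_analyticAt).and ((a₂.eventually_analyticAt).and hz'))
  have hnear : ∀ᶠ z in 𝓝 p, z ∈ Metric.ball p r := Metric.ball_mem_nhds p hr
  obtain ⟨q, hq, hqb⟩ := (f₁.and_eventually hnear).exists
  have hzero : h₂ =ᶠ[𝓝 q] 0 := by
    have h1 : ∀ᶠ z in 𝓝 q, h₁ z ≠ 0 := (hball q hqb).1.continuousAt.eventually_ne hq
    have h2 : ∀ᶠ z in 𝓝 q, z ∈ Metric.ball p r := Metric.isOpen_ball.mem_nhds hqb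
    filter_upwards [h1, h2] with z hz1 hz2
    exact (mul_eq_zero.1 (hball z hz2).2.2).resolve_left hz1
  have hpre : IsPreconnected (Metric.ball p r) := (convex_ball p r).isPreconnected
  have hall := AnalyticOnNhd.eqOn_zero_of_preconnected_of_eventuallyEq_zero
    (fun z hz => (hball z hz).2.1) hpre hqb hzero
  obtain ⟨s, hs, hsb⟩ := (f₂.and_eventually hnear).exists
  exact hs (hall hsb)

lemma IsMero.const {n : ℕ} (c : ℂ) : IsMero (fun _ : Fin n → ℂ => c) := fun _ =>
  ⟨fun _ => c, fun _ => 1, analyticAt_const, analyticAt_const,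
    (Eventually.of_forall fun _ => one_ne_zero).frequently, by simp⟩

lemma IsMero.add {n : ℕ} {f₁ f₂ : (Fin n → ℂ) → ℂ} (m₁ : IsMero f₁) (m₂ : IsMero f₂) :
    IsMero (f₁ + f₂) := by
  intro p
  obtain ⟨g₁, h₁, ag₁, ah₁, n₁, e₁⟩ := m₁ p
  obtain ⟨g₂, h₂, ag₂, ah₂, n₂, e₂⟩ := m₂ p
  refine ⟨g₁ * h₂ + g₂ * h₁, h₁ * h₂, (ag₁.mul ah₂).add (ag₂.mul ah₁), ah₁.mul ah₂,
    frequently_mul_ne_zero ah₁ ah₂ n₁ n₂, ?_⟩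
  filter_upwards [e₁, e₂] with z hz₁ hz₂ hz
  have ha : h₁ z ≠ 0 := left_ne_zero_of_mul hz
  have hb : h₂ z ≠ 0 := right_ne_zero_of_mul hz
  simp only [Pi.add_apply, Pi.mul_apply, hz₁ ha, hz₂ hb]
  field_simp

lemma IsMero.mul {n : ℕ} {f₁ f₂ : (Fin n → ℂ) → ℂ} (m₁ : IsMero f₁) (m₂ : IsMero f₂) :
    IsMero (f₁ * f₂) := by
  intro p
  obtain ⟨g₁, h₁, ag₁, ah₁, n₁, e₁⟩ := m₁ p
  obtain ⟨g₂, h₂, ag₂, ah₂, n₂, e₂⟩ := m₂ p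
  refine ⟨g₁ * g₂, h₁ * h₂, ag₁.mul ag₂, ah₁.mul ah₂,
    frequently_mul_ne_zero ah₁ ah₂ n₁ n₂, ?_⟩
  filter_upwards [e₁, e₂] with z hz₁ hz₂ hz
  have ha : h₁ z ≠ 0 := left_ne_zero_of_mul hz
  have hb : h₂ z ≠ 0 := right_ne_zero_of_mul hz
  simp only [Pi.mul_apply, hz₁ ha, hz₂ hb]
  field_simp

/-- The algebra of representatives of meromorphic functions on `ℂⁿ`. -/
def meroSub (n : ℕ) : Subalgebra ℂ ((Fin n → ℂ) → ℂ) where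
  carrier := {f | IsMero f}
  mul_mem' := IsMero.mul
  add_mem' := IsMero.add
  algebraMap_mem' := IsMero.const

/-- The ideal of representatives that vanish on a dense open set. -/
def meroNull (n : ℕ) : Ideal (meroSub n) where
  carrier := {f | Dense (interior {z | f.1 z = 0})}
  zero_mem' := by simp
  add_mem' := by
    intro f g hf hg
    refine (hf.inter_of_isOpen_left hg isOpen_interior).mono ?_
    rw [← interior_inter]
    refine interior_mono fun z hz => ?_
    have h1 : f.1 z = 0 := hz.1
    have h2 : g.1 z = 0 := hz.2
    simp [h1, h2]
  smul_mem' := by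
    intro c f hf
    refine hf.mono (interior_mono fun z hz => ?_)
    have h1 : f.1 z = 0 := hz
    simp [h1]

/-- The algebra `ℳ` of meromorphic functions on `ℂⁿ`: two representatives give the same
meromorphic function when they agree on a dense open set. -/
abbrev Mero (n : ℕ) : Type := meroSub n ⧸ meroNull n

/-- The coordinate permutation `ξ ↦ ξ ∘ w` of `ℂⁿ`. -/
def permHomeo {n : ℕ} (w : Equiv.Perm (Fin n)) : (Fin n → ℂ) ≃ₜ (Fin n → ℂ) where
  toFun z := z ∘ w
  invFun z := z ∘ w.symm
  left_inv z := by ext; simp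
  right_inv z := by ext; simp
  continuous_toFun := by fun_prop
  continuous_invFun := by fun_prop

lemma analyticAt_permHomeo {n : ℕ} (w : Equiv.Perm (Fin n)) (p : Fin n → ℂ) :
    AnalyticAt ℂ (permHomeo w) p :=
  (LinearMap.toContinuousLinearMap (LinearMap.funLeft ℂ ℂ w)).analyticAt p

lemma IsMero.comp_perm {n : ℕ} {f : (Fin n → ℂ) → ℂ} (hf : IsMero f) (w : Equiv.Perm (Fin n)) :
    IsMero (fun z => f (permHomeo w z)) := by
  intro p
  obtain ⟨g, h, ag, ah, hn, he⟩ := hf (permHomeo w p)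
  refine ⟨fun z => g (permHomeo w z), fun z => h (permHomeo w z),
    ag.comp (analyticAt_permHomeo w p), ah.comp (analyticAt_permHomeo w p), ?_, ?_⟩
  · rw [← (permHomeo w).map_nhds_eq p] at hn
    exact hn
  · rw [← (permHomeo w).map_nhds_eq p] at he
    exact he

/-- `f(ξ) ↦ f(w ξ)` on representatives. -/
def permSub {n : ℕ} (w : Equiv.Perm (Fin n)) : meroSub n →ₐ[ℂ] meroSub n where
  toFun f := ⟨fun z => f.1 (permHomeo w z), IsMero.comp_perm f.2 w⟩
  map_one' := rfl
  map_mul' _ _ := rfl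
  map_zero' := rfl
  map_add' _ _ := rfl
  commutes' _ := rfl

lemma meroNull_le_comap {n : ℕ} (w : Equiv.Perm (Fin n)) :
    meroNull n ≤ (meroNull n).comap (permSub w) := by
  intro f hf
  change Dense (interior ((permHomeo w) ⁻¹' {z | f.1 z = 0}))
  rw [← (permHomeo w).preimage_interior]
  exact Dense.preimage hf (permHomeo w).isOpenMap

/-- `f(ξ) ↦ f(w ξ)` on meromorphic functions, where `w ξ = ξ ∘ w`; for `w = s_{ij}` the
point `w ξ` is `ξ` with the coordinates `i` and `j` exchanged. -/
def permMero {n : ℕ} (w : Equiv.Perm (Fin n)) : Mero n →ₐ[ℂ] Mero n :=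
  Ideal.quotientMapₐ (meroNull n) (permSub w) (meroNull_le_comap w)

/-- (Representatives of) meromorphic functions of one complex variable. -/
abbrev MeroOne : Type := {f : ℂ → ℂ // Meromorphic f}

lemma isMero_diff {n : ℕ} (f : MeroOne) (i j : Fin n) :
    IsMero (fun x : Fin n → ℂ => f.1 (x i - x j)) := by
  by_cases hij : i = j
  · subst hij
    simpa using IsMero.const (n := n) (f.1 0)
  intro p
  obtain ⟨N, hN⟩ := f.2 (p i - p j)
  have hl : AnalyticAt ℂ (fun x : Fin n → ℂ => x i - x j) p :=
    (LinearMap.toContinuousLinearMap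
      (LinearMap.proj (R := ℂ) (φ := fun _ : Fin n => ℂ) i - LinearMap.proj j)).analyticAt p
  refine ⟨fun x => (x i - x j - (p i - p j)) ^ N * f.1 (x i - x j),
    fun x => (x i - x j - (p i - p j)) ^ N, ?_, (hl.sub analyticAt_const).pow N, ?_, ?_⟩
  · exact AnalyticAt.fun_comp (f := fun x : Fin n → ℂ => x i - x j) hN hl
  · have ht : Tendsto (fun t : ℂ => p + (Pi.single i t : Fin n → ℂ)) (𝓝[≠] 0) (𝓝 p) := by
      have hc : Continuous (fun t : ℂ => p + (Pi.single i t : Fin n → ℂ)) :=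
        continuous_const.add (continuous_single (A := fun _ : Fin n => ℂ) i)
      have h0 := hc.tendsto 0
      simp only [Pi.single_zero, add_zero] at h0
      exact h0.mono_left nhdsWithin_le_nhds
    refine ht.frequently (Eventually.frequently ?_)
    filter_upwards [self_mem_nhdsWithin] with t ht
    have : (p + (Pi.single i t : Fin n → ℂ)) i - (p + (Pi.single i t : Fin n → ℂ)) j -
        (p i - p j) = t := by
      simp [Pi.single_eq_of_ne (Ne.symm hij)]
    rw [this]
    exact pow_ne_zero _ ht
  · exact Eventually.of_forall fun x hx => (mul_div_cancel_left₀ _ hx).symm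

/-- The meromorphic function `f(x_i - x_j)` on `ℂⁿ` (used for `i ≠ j` only). -/
def diffMero {n : ℕ} (f : MeroOne) (i j : Fin n) : Mero n :=
  Ideal.Quotient.mk (meroNull n) ⟨fun x => f.1 (x i - x j), isMero_diff f i j⟩

/-! ### The deformed Fomin–Kirillov algebra -/

/-- Generators: the functions in `ℳ` and the symbols `⟨ij⟩`. -/
abbrev Gen (n : ℕ) : Type := Mero n ⊕ (Fin n × Fin n)

abbrev genFun {n : ℕ} (f : Mero n) : FreeAlgebra ℂ (Gen n) := FreeAlgebra.ι ℂ (Sum.inl f)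

abbrev genSym {n : ℕ} (i j : Fin n) : FreeAlgebra ℂ (Gen n) := FreeAlgebra.ι ℂ (Sum.inr (i, j))

/-- Defining relations. The first three say that `ℳ` maps by an algebra homomorphism; `diag` discards
the symbols `⟨ii⟩`, which are not generators of the algebra; `skew` is the convention
`⟨ji⟩ = -⟨ij⟩`. -/
inductive Rel {n : ℕ} (φ ψ : Fin n → Fin n → MeroOne) :
    FreeAlgebra ℂ (Gen n) → FreeAlgebra ℂ (Gen n) → Prop
  | fun_const (c : ℂ) :
      Rel φ ψ (genFun (algebraMap ℂ (Mero n) c)) (algebraMap ℂ (FreeAlgebra ℂ (Gen n)) c)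
  | fun_add (f g : Mero n) : Rel φ ψ (genFun (f + g)) (genFun f + genFun g)
  | fun_mul (f g : Mero n) : Rel φ ψ (genFun (f * g)) (genFun f * genFun g)
  | diag (i : Fin n) : Rel φ ψ (genSym i i) 0
  | skew (i j : Fin n) : i ≠ j → Rel φ ψ (genSym j i) (-genSym i j)
  | square (i j : Fin n) : i ≠ j →
      Rel φ ψ (genSym i j * genSym i j) (genFun (diffMero (ψ i j) i j))
  | comm (i j k l : Fin n) : i ≠ j → k ≠ l → i ≠ k → i ≠ l → j ≠ k → j ≠ l →
      Rel φ ψ (genSym i j * genSym k l) (genSym k l * genSym i j)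
  | triple (i j k : Fin n) : i ≠ j → j ≠ k → i ≠ k →
      Rel φ ψ (genSym i j * genSym j k + genSym j k * genSym k i + genSym k i * genSym i j) 0
  | cross (i j : Fin n) (f : Mero n) : i ≠ j →
      Rel φ ψ ((genSym i j - genFun (diffMero (φ i j) i j)) * genFun f)
        (genFun (permMero (Equiv.swap i j) f) * (genSym i j - genFun (diffMero (φ i j) i j)))

/-- The algebra `ℰ̃ₙ(φ_{ij}, ψ_{ij})`. -/
abbrev DeformedFK {n : ℕ} (φ ψ : Fin n → Fin n → MeroOne) : Type := RingQuot (Rel φ ψ)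

variable {n : ℕ} (φ ψ : Fin n → Fin n → MeroOne)

/-- The element `⟨ij⟩`. -/
def sym (i j : Fin n) : DeformedFK φ ψ := RingQuot.mkAlgHom ℂ (Rel φ ψ) (genSym i j)

/-- The structure map from meromorphic functions. -/
def ofMero : Mero n →ₐ[ℂ] DeformedFK φ ψ :=
  AlgHom.ofLinearMap
    { toFun := fun f => RingQuot.mkAlgHom ℂ (Rel φ ψ) (genFun f)
      map_add' := fun f g => by
        rw [RingQuot.mkAlgHom_rel ℂ (Rel.fun_add f g), map_add]
      map_smul' := fun c f => by
        rw [Algebra.smul_def, RingQuot.mkAlgHom_rel ℂ (Rel.fun_mul _ f), map_mul,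
          RingQuot.mkAlgHom_rel ℂ (Rel.fun_const c), AlgHom.commutes, RingHom.id_apply,
          Algebra.smul_def] }
    (by
      have h := RingQuot.mkAlgHom_rel ℂ (Rel.fun_const (φ := φ) (ψ := ψ) 1)
      rw [map_one, map_one, map_one] at h
      exact h)
    (fun f g => by
      change RingQuot.mkAlgHom ℂ (Rel φ ψ) (genFun (f * g)) = _
      rw [RingQuot.mkAlgHom_rel ℂ (Rel.fun_mul f g), map_mul]
      rfl)

/-- The bracket `[ij] = ⟨ij⟩ - φ_{ij}(x_i - x_j)`. -/
def bracket (i j : Fin n) : DeformedFK φ ψ :=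
  sym φ ψ i j - ofMero φ ψ (diffMero (φ i j) i j)

/-- The Dunkl element `θ_i = ∑_{j ≠ i} [ij]`. -/
def dunkl (i : Fin n) : DeformedFK φ ψ := ∑ j ∈ Finset.univ.erase i, bracket φ ψ i j

/-! ### The elliptic case -/

/-- `φ_{ij}(z) = a / z`. -/
def ratPhi (n : ℕ) (a : ℂ) : Fin n → Fin n → MeroOne := fun _ _ =>
  ⟨fun z => a / z, fun x => (MeromorphicAt.const a x).div (MeromorphicAt.id x)⟩

/-- The Weierstrass function of the period lattice of `L`. -/
def wp (L : PeriodPair) : MeroOne := ⟨L.weierstrassP, L.meromorphic_weierstrassP⟩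

/-- `ψ_{ij}(z) = a² / z² - (℘(z) - ℘(λ_i - λ_j))`. -/
def ellPsi {n : ℕ} (L : PeriodPair) (a : ℂ) (lam : Fin n → ℂ) : Fin n → Fin n → MeroOne :=
  fun i j => ⟨fun z => a ^ 2 / z ^ 2 - (L.weierstrassP z - L.weierstrassP (lam i - lam j)),
    fun x => ((MeromorphicAt.const (a ^ 2) x).div ((MeromorphicAt.id x).pow 2)).sub
      ((L.meromorphic_weierstrassP x).sub (MeromorphicAt.const _ x))⟩

/-- The elliptic deformation of the Fomin–Kirillov algebra. -/
abbrev EllFK {n : ℕ} (L : PeriodPair) (a : ℂ) (lam : Fin n → ℂ) : Type :=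
  DeformedFK (ratPhi n a) (ellPsi L a lam)

/-- `φ(I) = ∑ ∏_{i=1}^l ℘(x_{a_i} - x_{b_i})` for a set `I` with `2l` elements, the sum being over
the `(a, b)` with `I = {a_1, …, a_l, b_1, …, b_l}`, `a_1 < ⋯ < a_l` and `a_i < b_i`. -/
def matchSum {n : ℕ} (L : PeriodPair) (l : ℕ) (I : Finset (Fin n)) : Mero n :=
  open Classical in
  ∑ ab : (Fin l → Fin n) × (Fin l → Fin n) with
      I = Finset.univ.image ab.1 ∪ Finset.univ.image ab.2 ∧ StrictMono ab.1 ∧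
        ∀ i, ab.1 i < ab.2 i,
    ∏ i, diffMero (wp L) (ab.1 i) (ab.2 i)

/-- The sum of the monomials `[a_1 b_1] ⋯ [a_m b_m]` over the sequences with `a_i ∈ S` distinct,
`b_i ∉ I` and `b_1 ≤ ⋯ ≤ b_m`. -/
def pieriSum (m : ℕ) (S I : Finset (Fin n)) : DeformedFK φ ψ :=
  open Classical in
  ∑ ab : (Fin m → Fin n) × (Fin m → Fin n) with
      (∀ i, ab.1 i ∈ S) ∧ (∀ i, ab.2 i ∉ I) ∧ Function.Injective ab.1 ∧ Monotone ab.2,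
    (List.ofFn fun i => bracket φ ψ (ab.1 i) (ab.2 i)).prod

/-- The deformed elementary symmetric polynomials `E_k(I) = E_k(X_i | i ∈ I)` for coefficients
`c_{ij}`, obtained by adding the elements of `I` one at a time in increasing order. By
`defElem_one_insert` and `defElem_insert` below, the recursion holds for adding any `j ∉ I`. -/
def defElem (c : Fin n → Fin n → ℂ) : ℕ → Finset (Fin n) → MvPolynomial (Fin n) ℂ
  | 0, _ => 1
  | k + 1, I =>
    if h : I.Nonempty then
      defElem c (k + 1) (I.erase (I.max' h)) +
        defElem c k (I.erase (I.max' h)) * MvPolynomial.X (I.max' h) +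
        match k with
        | 0 => 0
        | k + 1 => ∑ i ∈ I.erase (I.max' h),
            MvPolynomial.C (c i (I.max' h)) * defElem c k ((I.erase (I.max' h)).erase i)
    else 0
  termination_by _ I => I.card
  decreasing_by
    · exact Finset.card_erase_lt_of_mem (I.max'_mem h)
    · exact Finset.card_erase_lt_of_mem (I.max'_mem h)
    · exact lt_of_le_of_lt (Finset.card_erase_le) (Finset.card_erase_lt_of_mem (I.max'_mem h))

/-- `E_{k-1}`, zero for `k = 0`. -/
def defElemPred (c : Fin n → Fin n → ℂ) : ℕ → Finset (Fin n) → MvPolynomial (Fin n) ℂ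
  | 0, _ => 0
  | k + 1, I => defElem c k I

lemma defElem_zero (c : Fin n → Fin n → ℂ) (I : Finset (Fin n)) : defElem c 0 I = 1 := by
  rw [defElem]

lemma defElem_succ_empty (c : Fin n → Fin n → ℂ) (k : ℕ) : defElem c (k + 1) ∅ = 0 := by
  rw [defElem]; simp

lemma defElem_max (c : Fin n → Fin n → ℂ) (k : ℕ) (I : Finset (Fin n)) (m : Fin n) (hm : m ∉ I)
    (hI : ∀ i ∈ I, i < m) :
    defElem c (k + 1) (insert m I) = defElem c (k + 1) I + defElem c k I * MvPolynomial.X m +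
      ∑ i ∈ I, MvPolynomial.C (c i m) * defElemPred c k (I.erase i) := by
  have hmax : (insert m I).max' (Finset.insert_nonempty m I) = m := by
    apply le_antisymm
    · refine Finset.max'_le _ _ _ fun y hy => ?_
      rcases Finset.mem_insert.1 hy with rfl | hy
      · exact le_rfl
      · exact (hI y hy).le
    · exact Finset.le_max' _ _ (Finset.mem_insert_self m I)
  rw [defElem, dif_pos (Finset.insert_nonempty m I), hmax, Finset.erase_insert hm]
  congr 1
  cases k <;> simp [defElemPred]

lemma defElem_insert_aux (c : Fin n → Fin n → ℂ) (hc : ∀ i j, c i j = c j i) (N : ℕ) :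
    ∀ (k : ℕ) (I : Finset (Fin n)) (j : Fin n), I.card ≤ N → j ∉ I →
    defElem c (k + 1) (insert j I) = defElem c (k + 1) I + defElem c k I * MvPolynomial.X j +
      ∑ i ∈ I, MvPolynomial.C (c i j) * defElemPred c k (I.erase i) := by
  induction N with
  | zero =>
    intro k I j hN hj
    have : I = ∅ := by simpa using hN
    subst this
    exact defElem_max c k ∅ j hj (by simp)
  | succ N ih =>
    intro k I j hN hj
    by_cases hlt : ∀ i ∈ I, i < j
    · exact defElem_max c k I j hj hlt
    have hne : I.Nonempty := by
      rw [Finset.nonempty_iff_ne_empty]; rintro rfl; simp at hlt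
    obtain ⟨m, J, hm, hJ, rfl⟩ : ∃ m J, m ∉ J ∧ (∀ i ∈ J, i < m) ∧ I = insert m J :=
      ⟨I.max' hne, I.erase (I.max' hne), by simp, fun i hi => I.lt_max'_of_mem_erase_max' hne hi,
        (Finset.insert_erase (I.max'_mem hne)).symm⟩
    have hjm : j ≠ m := fun h => hj (h ▸ Finset.mem_insert_self _ _)
    have hjJ : j ∉ J := fun h => hj (Finset.mem_insert_of_mem h)
    have hjlt : j < m := by
      by_contra h
      have hmj : m < j := lt_of_le_of_ne (not_lt.1 h) (Ne.symm hjm)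
      apply hlt
      intro i hi
      rcases Finset.mem_insert.1 hi with rfl | hi
      · exact hmj
      · exact (hJ i hi).trans hmj
    have hcard : J.card ≤ N := by
      rw [Finset.card_insert_of_notMem hm] at hN; omega
    have hmjJ : m ∉ insert j J := by
      simp [Ne.symm hjm, hm]
    have hmax' : ∀ i ∈ insert j J, i < m := by
      intro i hi
      rcases Finset.mem_insert.1 hi with rfl | hi
      · exact hjlt
      · exact hJ i hi
    rw [Finset.insert_comm, defElem_max c k _ m hmjJ hmax', ih k J j hcard hjJ,
      Finset.sum_insert hjJ, Finset.erase_insert hjJ, Finset.sum_insert hm, Finset.erase_insert hm,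
      defElem_max c k J m hm hJ]
    have hA : ∀ i ∈ J, (insert j J).erase i = insert j (J.erase i) := fun i hi =>
      Finset.erase_insert_of_ne (by rintro rfl; exact hjJ hi)
    have hB : ∀ i ∈ J, (insert m J).erase i = insert m (J.erase i) := fun i hi =>
      Finset.erase_insert_of_ne (by rintro rfl; exact hm hi)
    have hSA : ∑ i ∈ J, MvPolynomial.C (c i m) * defElemPred c k ((insert j J).erase i) =
        ∑ i ∈ J, MvPolynomial.C (c i m) * defElemPred c k (insert j (J.erase i)) :=
      Finset.sum_congr rfl fun i hi => by rw [hA i hi]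
    have hSB : ∑ i ∈ J, MvPolynomial.C (c i j) * defElemPred c k ((insert m J).erase i) =
        ∑ i ∈ J, MvPolynomial.C (c i j) * defElemPred c k (insert m (J.erase i)) :=
      Finset.sum_congr rfl fun i hi => by rw [hB i hi]
    rw [hSA, hSB]
    cases k with
    | zero =>
      simp only [defElemPred, defElem_zero, mul_zero, Finset.sum_const_zero]
      ring
    | succ k =>
      rw [ih k J j hcard hjJ, defElem_max c k J m hm hJ]
      simp only [defElemPred, hc j m]
      cases k with
      | zero =>
        simp only [defElem_zero, mul_zero, Finset.sum_const_zero]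
        ring
      | succ k =>
        have hI1 : ∀ i ∈ J, MvPolynomial.C (c i m) * defElem c (k + 1) (insert j (J.erase i)) =
            MvPolynomial.C (c i m) * defElem c (k + 1) (J.erase i) +
            MvPolynomial.C (c i m) * defElem c k (J.erase i) * MvPolynomial.X j +
            ∑ x ∈ J.erase i, MvPolynomial.C (c i m) *
              (MvPolynomial.C (c x j) * defElemPred c k ((J.erase i).erase x)) := fun i hi => by
          rw [ih k (J.erase i) j ((Finset.card_erase_le).trans hcard)
            (fun h => hjJ (Finset.mem_of_mem_erase h)), mul_add, mul_add, Finset.mul_sum, mul_assoc]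
        have hI2 : ∀ i ∈ J, MvPolynomial.C (c i j) * defElem c (k + 1) (insert m (J.erase i)) =
            MvPolynomial.C (c i j) * defElem c (k + 1) (J.erase i) +
            MvPolynomial.C (c i j) * defElem c k (J.erase i) * MvPolynomial.X m +
            ∑ x ∈ J.erase i, MvPolynomial.C (c i j) *
              (MvPolynomial.C (c x m) * defElemPred c k ((J.erase i).erase x)) := fun i hi => by
          rw [defElem_max c k (J.erase i) m (fun h => hm (Finset.mem_of_mem_erase h))
            (fun x hx => hJ x (Finset.mem_of_mem_erase hx)), mul_add, mul_add, Finset.mul_sum,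
            mul_assoc]
        have hswap : ∑ i ∈ J, ∑ x ∈ J.erase i, MvPolynomial.C (c i m) *
              (MvPolynomial.C (c x j) * defElemPred c k ((J.erase i).erase x)) =
            ∑ i ∈ J, ∑ x ∈ J.erase i, MvPolynomial.C (c i j) *
              (MvPolynomial.C (c x m) * defElemPred c k ((J.erase i).erase x)) := by
          rw [Finset.sum_comm' (t' := J) (s' := fun x => J.erase x)
            (by intro x y; simp only [Finset.mem_erase]; tauto)]
          refine Finset.sum_congr rfl fun i _ => Finset.sum_congr rfl fun x _ => ?_
          rw [Finset.erase_right_comm]; ring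
        rw [Finset.sum_congr rfl hI1, Finset.sum_congr rfl hI2]
        simp only [Finset.sum_add_distrib]
        rw [hswap]
        simp only [← Finset.sum_mul, defElemPred]
        ring

lemma defElem_one_insert (c : Fin n → Fin n → ℂ) (hc : ∀ i j, c i j = c j i)
    (I : Finset (Fin n)) (j : Fin n) (hj : j ∉ I) :
    defElem c 1 (insert j I) = defElem c 1 I + defElem c 0 I * MvPolynomial.X j := by
  simpa [defElemPred] using defElem_insert_aux c hc _ 0 I j le_rfl hj

/-- The recursion defining the deformed elementary symmetric polynomials. -/
lemma defElem_insert (c : Fin n → Fin n → ℂ) (hc : ∀ i j, c i j = c j i) (k : ℕ)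
    (I : Finset (Fin n)) (j : Fin n) (hj : j ∉ I) :
    defElem c (k + 2) (insert j I) = defElem c (k + 2) I + defElem c (k + 1) I * MvPolynomial.X j +
      ∑ i ∈ I, MvPolynomial.C (c i j) * defElem c k (I.erase i) :=
  defElem_insert_aux c hc _ (k + 1) I j le_rfl hj

/-- `c_{ij} = ℘(λ_i - λ_j)`. -/
def wpLam (L : PeriodPair) (lam : Fin n → ℂ) : Fin n → Fin n → ℂ :=
  fun i j => L.weierstrassP (lam i - lam j)

lemma wpLam_symm (L : PeriodPair) (lam : Fin n → ℂ) (i j : Fin n) :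
    wpLam L lam i j = wpLam L lam j i := by
  rw [wpLam, wpLam, ← L.weierstrassP_neg, neg_sub]

end EllipticFK

end

namespace EllipticFK

/-! ### Convolution of functions of finite sets -/

section SetConv

variable {ι R : Type*} [DecidableEq ι]

/-! Both sides of the formula obey the same recursion in `I`. The brackets enter only through
`IsBracket`: skew symmetry, commutation for disjoint index pairs, the triple relation, [ij]² = c_ij
- w_ij with c_ij central, and the rule by which [ij] permutes the indices of w.

Write P_b for `symProd r b`, F_K for `fullSum r K`, φ for the hafnian of w and * for `setConv`. The
right-hand side is the sum of (φ * F_{Iᶜ})(W) over the k-element W ⊆ I. By `fullSum_insert`, F_{K ∪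
b} = P_b * F_K, because P_a and P_b commute on disjoint sets.

Let j ∉ I and let K be the complement of I ∪ {j}, so that θ_j = ∑_{b ∈ K} [jb] - ∑_{i ∈ I} [ij]. In
E_k(I) θ_j the products of the W-term by [ij] with i ∈ I \ W cancel against terms of E_{k+1}(I),
found by splitting off the last factor of P_j. What remains is, for each W, the identity
`setConv_hafnian_mul` for (φ * P_j * F_K)(W) times ∑_{b ∈ K} [jb] - ∑_{i ∈ W} [ij]. It depends on
where i lies.

If i is used by F_K, the triple relation (`fullSum_insert_eq`) makes the terms telescope, together
with those of [jb], to F_K(S ∪ j).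

If i is used by P_j, cutting the word at the factor [ij] leaves a loop [ij]⋯[ij]. By `loopSum_eq`
the loops on U add up to ∑ c_uj P_u(U \ u), corrected by -w_uj when U = {u}. The c-terms are those
of the recursion with E_{k-1}(I \ i).

If i is used by φ, expand φ along i. The result cancels the corrections w_ij after these are moved
to the left through P_j. Only w_ij φ(W \ i) is left, and this is the expansion of φ(W ∪ j) along j.

Commutation of the Dunkl elements needs only skew symmetry, disjoint commutation and the triple
relation. -/

lemma sum_powerset_sum_mem [AddCommMonoid R] (W : Finset ι) (h : ι → Finset ι → Finset ι → R) :
    ∑ T ∈ W.powerset, ∑ i ∈ T, h i (T.erase i) (W \ T) =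
      ∑ i ∈ W, ∑ T ∈ (W.erase i).powerset, h i T (W.erase i \ T) := by
  rw [Finset.sum_sigma', Finset.sum_sigma']
  refine Finset.sum_bij' (fun x _ => ⟨x.2, x.1.erase x.2⟩) (fun x _ => ⟨insert x.1 x.2, x.1⟩)
    ?_ ?_ ?_ ?_ ?_
  · rintro ⟨T, i⟩ hx
    simp only [Finset.mem_sigma, Finset.mem_powerset] at hx ⊢
    exact ⟨hx.1 hx.2, Finset.erase_subset_erase _ hx.1⟩
  · rintro ⟨i, T⟩ hx
    simp only [Finset.mem_sigma, Finset.mem_powerset] at hx ⊢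
    exact ⟨Finset.insert_subset hx.1 (hx.2.trans (Finset.erase_subset _ _)),
      Finset.mem_insert_self _ _⟩
  · rintro ⟨T, i⟩ hx
    simp only [Finset.mem_sigma, Finset.mem_powerset] at hx
    simp [Finset.insert_erase hx.2]
  · rintro ⟨i, T⟩ hx
    simp only [Finset.mem_sigma, Finset.mem_powerset] at hx
    have : i ∉ T := fun hi => by simpa using hx.2 hi
    simp [Finset.erase_insert this]
  · rintro ⟨T, i⟩ hx
    simp only [Finset.mem_sigma, Finset.mem_powerset] at hx
    congr 1
    ext y
    simp only [Finset.mem_sdiff, Finset.mem_erase]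
    have := hx.2
    grind

lemma sum_powerset_sum_sdiff [AddCommMonoid R] (W : Finset ι)
    (h : ι → Finset ι → Finset ι → R) :
    ∑ T ∈ W.powerset, ∑ i ∈ W \ T, h i T ((W \ T).erase i) =
      ∑ i ∈ W, ∑ T ∈ (W.erase i).powerset, h i T (W.erase i \ T) := by
  rw [Finset.sum_sigma', Finset.sum_sigma']
  refine Finset.sum_bij' (fun x _ => ⟨x.2, x.1⟩) (fun x _ => ⟨x.2, x.1⟩) ?_ ?_ ?_ ?_ ?_
  · rintro ⟨T, i⟩ hx
    simp only [Finset.mem_sigma, Finset.mem_powerset, Finset.mem_sdiff] at hx ⊢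
    exact ⟨hx.2.1, Finset.subset_erase.2 ⟨hx.1, hx.2.2⟩⟩
  · rintro ⟨i, T⟩ hx
    simp only [Finset.mem_sigma, Finset.mem_powerset, Finset.mem_sdiff] at hx ⊢
    exact ⟨hx.2.trans (Finset.erase_subset _ _), hx.1, fun hi => by simpa using hx.2 hi⟩
  · intros; rfl
  · intros; rfl
  · rintro ⟨T, i⟩ hx
    rw [Finset.erase_sdiff_comm]

lemma sum_powersetCard_sum_mem [AddCommMonoid R] (k : ℕ) (I : Finset ι)
    (h : ι → Finset ι → R) :
    ∑ W ∈ I.powersetCard (k + 1), ∑ i ∈ W, h i (W.erase i) =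
      ∑ i ∈ I, ∑ W ∈ (I.erase i).powersetCard k, h i W := by
  rw [Finset.sum_sigma', Finset.sum_sigma']
  refine Finset.sum_bij' (fun x _ => ⟨x.2, x.1.erase x.2⟩) (fun x _ => ⟨insert x.1 x.2, x.1⟩)
    ?_ ?_ ?_ ?_ ?_
  · rintro ⟨T, i⟩ hx
    simp only [Finset.mem_sigma, Finset.mem_powersetCard] at hx ⊢
    exact ⟨hx.1.1 hx.2, Finset.erase_subset_erase _ hx.1.1, by
      rw [Finset.card_erase_of_mem hx.2, hx.1.2]; rfl⟩
  · rintro ⟨i, T⟩ hx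
    simp only [Finset.mem_sigma, Finset.mem_powersetCard] at hx ⊢
    have : i ∉ T := fun hi => by simpa using hx.2.1 hi
    exact ⟨⟨Finset.insert_subset hx.1 (hx.2.1.trans (Finset.erase_subset _ _)), by
      rw [Finset.card_insert_of_notMem this, hx.2.2]⟩, Finset.mem_insert_self _ _⟩
  · rintro ⟨T, i⟩ hx
    simp only [Finset.mem_sigma, Finset.mem_powersetCard] at hx
    simp [Finset.insert_erase hx.2]
  · rintro ⟨i, T⟩ hx
    simp only [Finset.mem_sigma, Finset.mem_powersetCard] at hx
    have : i ∉ T := fun hi => by simpa using hx.2.1 hi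
    simp [Finset.erase_insert this]
  · intros; rfl

lemma sum_powersetCard_sum_sdiff [AddCommMonoid R] (k : ℕ) (I : Finset ι)
    (h : ι → Finset ι → R) :
    ∑ W ∈ I.powersetCard k, ∑ i ∈ I \ W, h i W =
      ∑ i ∈ I, ∑ W ∈ (I.erase i).powersetCard k, h i W := by
  rw [Finset.sum_sigma', Finset.sum_sigma']
  refine Finset.sum_bij' (fun x _ => ⟨x.2, x.1⟩) (fun x _ => ⟨x.2, x.1⟩) ?_ ?_ ?_ ?_ ?_
  · rintro ⟨T, i⟩ hx
    simp only [Finset.mem_sigma, Finset.mem_powersetCard, Finset.mem_sdiff] at hx ⊢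
    exact ⟨hx.2.1, Finset.subset_erase.2 ⟨hx.1.1, hx.2.2⟩, hx.1.2⟩
  · rintro ⟨i, T⟩ hx
    simp only [Finset.mem_sigma, Finset.mem_powersetCard, Finset.mem_sdiff] at hx ⊢
    exact ⟨⟨hx.2.1.trans (Finset.erase_subset _ _), hx.2.2⟩, hx.1,
      fun hi => by simpa using hx.2.1 hi⟩
  · intros; rfl
  · intros; rfl
  · intros; rfl

variable [Ring R]

/-- The convolution `(f * g)(W) = ∑ f(T) g(W \ T)` of functions of finite sets. -/
def setConv (f g : Finset ι → R) (W : Finset ι) : R := ∑ T ∈ W.powerset, f T * g (W \ T)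

lemma setConv_congr {f f' g g' : Finset ι → R} {W : Finset ι} (hf : ∀ T ⊆ W, f T = f' T)
    (hg : ∀ T ⊆ W, g T = g' T) : setConv f g W = setConv f' g' W :=
  Finset.sum_congr rfl fun T hT => by
    rw [hf T (Finset.mem_powerset.1 hT), hg _ Finset.sdiff_subset]

@[simp] lemma setConv_empty (f g : Finset ι → R) : setConv f g ∅ = f ∅ * g ∅ := by
  simp [setConv]

lemma setConv_comm {f g : Finset ι → R} {W : Finset ι}
    (h : ∀ T ⊆ W, Commute (f T) (g (W \ T))) : setConv f g W = setConv g f W := by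
  refine Finset.sum_bij' (fun T _ => W \ T) (fun T _ => W \ T) ?_ ?_ ?_ ?_ ?_
  · intro T _
    exact Finset.mem_powerset.2 Finset.sdiff_subset
  · intro T _
    exact Finset.mem_powerset.2 Finset.sdiff_subset
  · intro T hT
    exact Finset.sdiff_sdiff_eq_self (Finset.mem_powerset.1 hT)
  · intro T hT
    exact Finset.sdiff_sdiff_eq_self (Finset.mem_powerset.1 hT)
  · intro T hT
    rw [Finset.sdiff_sdiff_eq_self (Finset.mem_powerset.1 hT),
      (h T (Finset.mem_powerset.1 hT)).eq]

lemma setConv_assoc (f g h : Finset ι → R) (W : Finset ι) :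
    setConv (setConv f g) h W = setConv f (setConv g h) W := by
  simp only [setConv, Finset.sum_mul, Finset.mul_sum]
  rw [Finset.sum_sigma', Finset.sum_sigma']
  refine Finset.sum_bij' (fun x _ => ⟨x.2, x.1 \ x.2⟩) (fun x _ => ⟨x.1 ∪ x.2, x.1⟩) ?_ ?_ ?_ ?_ ?_
  · rintro ⟨T, V⟩ hx
    simp only [Finset.mem_sigma, Finset.mem_powerset] at hx ⊢
    exact ⟨hx.2.trans hx.1, Finset.sdiff_subset_sdiff hx.1 subset_rfl⟩
  · rintro ⟨V, U⟩ hx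
    simp only [Finset.mem_sigma, Finset.mem_powerset] at hx ⊢
    exact ⟨Finset.union_subset hx.1 (hx.2.trans Finset.sdiff_subset), Finset.subset_union_left⟩
  · rintro ⟨T, V⟩ hx
    simp only [Finset.mem_sigma, Finset.mem_powerset] at hx
    simp [Finset.union_sdiff_of_subset hx.2]
  · rintro ⟨V, U⟩ hx
    simp only [Finset.mem_sigma, Finset.mem_powerset] at hx
    have : (V ∪ U) \ V = U := by
      rw [Finset.union_sdiff_left]
      exact Finset.sdiff_eq_self_of_disjoint
        (Finset.disjoint_of_subset_left hx.2 Finset.sdiff_disjoint)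
    simp [this]
  · rintro ⟨T, V⟩ hx
    simp only [Finset.mem_sigma, Finset.mem_powerset] at hx
    have : (W \ V) \ (T \ V) = W \ T := by
      ext y
      have := @hx.2 y
      simp only [Finset.mem_sdiff]
      tauto
    simp only [this, mul_assoc]

lemma setConv_add_left (f f' g : Finset ι → R) (W : Finset ι) :
    setConv (fun T => f T + f' T) g W = setConv f g W + setConv f' g W := by
  simp [setConv, add_mul, Finset.sum_add_distrib]

lemma setConv_sub_left (f f' g : Finset ι → R) (W : Finset ι) :
    setConv (fun T => f T - f' T) g W = setConv f g W - setConv f' g W := by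
  simp [setConv, sub_mul, Finset.sum_sub_distrib]

lemma setConv_add_right (f g g' : Finset ι → R) (W : Finset ι) :
    setConv f (fun T => g T + g' T) W = setConv f g W + setConv f g' W := by
  simp [setConv, mul_add, Finset.sum_add_distrib]

lemma setConv_sub_right (f g g' : Finset ι → R) (W : Finset ι) :
    setConv f (fun T => g T - g' T) W = setConv f g W - setConv f g' W := by
  simp [setConv, mul_sub, Finset.sum_sub_distrib]

lemma setConv_insert (f g : Finset ι → R) {W : Finset ι} {j : ι} (hj : j ∉ W) :
    setConv f g (insert j W) =
      setConv f (fun T => g (insert j T)) W + setConv (fun T => f (insert j T)) g W := by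
  rw [setConv, Finset.sum_powerset_insert hj]
  congr 1
  · refine Finset.sum_congr rfl fun T hT => ?_
    rw [Finset.insert_sdiff_of_notMem _ fun h => hj (Finset.mem_powerset.1 hT h)]
  · refine Finset.sum_congr rfl fun T hT => ?_
    rw [Finset.insert_sdiff_insert, Finset.sdiff_insert_of_notMem hj]

/-- Marking an element of one part of a splitting of W amounts to marking it in W first and then
splitting the rest. -/
lemma setConv_sum_left (f : ι → Finset ι → R) (g : Finset ι → R) (W : Finset ι) :
    setConv (fun T => ∑ i ∈ T, f i (T.erase i)) g W =
      ∑ i ∈ W, setConv (f i) g (W.erase i) := by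
  simp only [setConv, Finset.sum_mul]
  exact sum_powerset_sum_mem W fun i T U => f i T * g U

lemma setConv_sum_right (f : Finset ι → R) (g : ι → Finset ι → R) (W : Finset ι) :
    setConv f (fun T => ∑ i ∈ T, g i (T.erase i)) W =
      ∑ i ∈ W, setConv f (g i) (W.erase i) := by
  simp only [setConv, Finset.mul_sum]
  exact sum_powerset_sum_sdiff W fun i T U => f T * g i U

/-- The indicator of `∅` is the unit of the convolution; it accounts for the empty word whenever a
factor is split off. -/
lemma setConv_ite_empty_right (f : Finset ι → R) (y : R) (W : Finset ι) :
    setConv f (fun T => if T = ∅ then y else 0) W = f W * y := by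
  rw [setConv, Finset.sum_eq_single_of_mem W (by simp)]
  · simp
  · intro T hT hne
    rw [if_neg, mul_zero]
    rw [Finset.sdiff_eq_empty_iff_subset]
    exact fun h => hne (subset_antisymm (Finset.mem_powerset.1 hT) h)

lemma setConv_ite_empty_left (f : Finset ι → R) (y : R) (W : Finset ι) :
    setConv (fun T => if T = ∅ then y else 0) f W = y * f W := by
  rw [setConv, Finset.sum_eq_single_of_mem ∅ (by simp)]
  · simp
  · intro T hT hne
    rw [if_neg hne, zero_mul]

lemma setConv_mul_commute (f g : Finset ι → R) (x : R) (W : Finset ι)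
    (h : ∀ T ⊆ W, Commute (g T) x) :
    setConv f g W * x = setConv (fun T => f T * x) g W := by
  rw [setConv, setConv, Finset.sum_mul]
  refine Finset.sum_congr rfl fun T _ => ?_
  rw [mul_assoc, (h _ Finset.sdiff_subset).eq, mul_assoc]

lemma mul_setConv_commute (f g : Finset ι → R) (x : R) (W : Finset ι)
    (h : ∀ T ⊆ W, Commute x (f T)) :
    x * setConv f g W = setConv f (fun T => x * g T) W := by
  rw [setConv, setConv, Finset.mul_sum]
  refine Finset.sum_congr rfl fun T hT => ?_
  rw [← mul_assoc, (h _ (Finset.mem_powerset.1 hT)).eq, mul_assoc]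

lemma setConv_mul_right (f g : Finset ι → R) (x : R) (W : Finset ι) :
    setConv f g W * x = setConv f (fun T => g T * x) W := by
  simp [setConv, Finset.sum_mul, mul_assoc]

lemma mul_setConv (f g : Finset ι → R) (x : R) (W : Finset ι) :
    x * setConv f g W = setConv (fun T => x * f T) g W := by
  simp [setConv, Finset.mul_sum, mul_assoc]

end SetConv

end EllipticFK

namespace EllipticFK

/-! ### Pieri sums in a ring with Fomin–Kirillov brackets -/

section Bracket

variable {ι R : Type*} [LinearOrder ι] [Ring R]

/-- Elements `r i j` of a ring which satisfy the relations of the brackets `[ij]`, whose squares are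
`c i j - w i j` for central `c i j`, and which permute the indices of `w`. -/
structure IsBracket (r c w : ι → ι → R) : Prop where
  skew : ∀ i j, i ≠ j → r j i = -r i j
  comm : ∀ i j k l, i ≠ j → k ≠ l → i ≠ k → i ≠ l → j ≠ k → j ≠ l → Commute (r i j) (r k l)
  triple : ∀ i j k, i ≠ j → j ≠ k → i ≠ k → r i j * r j k + r j k * r k i + r k i * r i j = 0
  sq : ∀ i j, i ≠ j → r i j * r i j = c i j - w i j
  c_comm : ∀ i j x, Commute (c i j) x
  cross : ∀ i j k l, i ≠ j →
    r i j * w k l = w (Equiv.swap i j k) (Equiv.swap i j l) * r i j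

/-- The sum of the products `r a₁ b₁ ⋯ r aₘ bₘ` over the sequences of distinct `aᵢ ∈ S` and of
`bᵢ ∈ K` with `b₁ ≤ ⋯ ≤ bₘ`. -/
def seqSum (r : ι → ι → R) : ℕ → Finset ι → Finset ι → R
  | 0, _, _ => 1
  | m + 1, K, S => ∑ a ∈ S, ∑ b ∈ K, r a b * seqSum r m (K.filter (b ≤ ·)) (S.erase a)

/-- The part of `seqSum` formed by the sequences in which every element of `S` occurs. -/
def fullSum (r : ι → ι → R) (K S : Finset ι) : R := seqSum r S.card K S

/-- The sum of the products of all `r s b`, `s ∈ S`, over all orderings of `S`. -/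
def symProd (r : ι → ι → R) (b : ι) (S : Finset ι) : R := fullSum r {b} S

/-- The sum over the orderings `u₁, …, uₘ` of `U` of `r u₁ j ⋯ r uₘ j * r u₁ j`. -/
def loopSum (r : ι → ι → R) (j : ι) (U : Finset ι) : R :=
  ∑ u ∈ U, r u j * symProd r j (U.erase u) * r u j

variable {r c w : ι → ι → R}

lemma seqSum_eq_sum_fullSum (m : ℕ) (K S : Finset ι) :
    seqSum r m K S = ∑ T ∈ S.powersetCard m, fullSum r K T := by
  induction m generalizing K S with
  | zero => simp [seqSum, fullSum]
  | succ m ih =>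
    have h : ∀ T ∈ S.powersetCard (m + 1), fullSum r K T =
        ∑ a ∈ T, ∑ b ∈ K, r a b * fullSum r (K.filter (b ≤ ·)) (T.erase a) := fun T hT => by
      have hc := (Finset.mem_powersetCard.1 hT).2
      rw [fullSum, hc, seqSum]
      refine Finset.sum_congr rfl fun a ha => ?_
      rw [show m = (T.erase a).card by rw [Finset.card_erase_of_mem ha, hc]; rfl]
      rfl
    rw [Finset.sum_congr rfl h, sum_powersetCard_sum_mem m S fun a T =>
      ∑ b ∈ K, r a b * fullSum r (K.filter (b ≤ ·)) T, seqSum]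
    refine Finset.sum_congr rfl fun a _ => ?_
    rw [Finset.sum_comm]
    refine Finset.sum_congr rfl fun b _ => ?_
    rw [ih, Finset.mul_sum]

@[simp] lemma fullSum_empty (K : Finset ι) : fullSum r K ∅ = 1 := rfl

@[simp] lemma symProd_empty (b : ι) : symProd r b ∅ = 1 := rfl

lemma fullSum_eq_sum (K : Finset ι) {S : Finset ι} (hS : S.Nonempty) :
    fullSum r K S = ∑ a ∈ S, ∑ b ∈ K, r a b * fullSum r (K.filter (b ≤ ·)) (S.erase a) := by
  obtain ⟨m, hm⟩ : ∃ m, S.card = m + 1 :=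
    Nat.exists_eq_succ_of_ne_zero (Finset.card_pos.2 hS).ne'
  rw [fullSum, hm, seqSum]
  refine Finset.sum_congr rfl fun a ha => ?_
  rw [show m = (S.erase a).card by rw [Finset.card_erase_of_mem ha, hm]; rfl]
  rfl

lemma fullSum_empty_left {S : Finset ι} (hS : S.Nonempty) : fullSum r ∅ S = 0 := by
  simp [fullSum_eq_sum _ hS]

lemma symProd_eq_sum (b : ι) {S : Finset ι} (hS : S.Nonempty) :
    symProd r b S = ∑ a ∈ S, r a b * symProd r b (S.erase a) := by
  rw [symProd, fullSum_eq_sum _ hS]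
  simp [symProd, Finset.filter_singleton]

lemma fullSum_commute {K S : Finset ι} {x : R} (h : ∀ s ∈ S, ∀ b ∈ K, Commute (r s b) x) :
    Commute (fullSum r K S) x := by
  induction S using Finset.strongInduction generalizing K with
  | H S ih =>
    rcases S.eq_empty_or_nonempty with rfl | hS
    · simp
    rw [fullSum_eq_sum _ hS]
    refine Commute.sum_left _ _ _ fun a ha => Commute.sum_left _ _ _ fun b hb => ?_
    exact (h a ha b hb).mul_left (ih _ (Finset.erase_ssubset ha) fun s hs b' hb' =>
      h s (Finset.mem_of_mem_erase hs) b' (Finset.mem_of_mem_filter _ hb'))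

lemma symProd_commute {b : ι} {S : Finset ι} {x : R} (h : ∀ s ∈ S, Commute (r s b) x) :
    Commute (symProd r b S) x :=
  fullSum_commute fun s hs b' hb' => by rw [Finset.mem_singleton.1 hb']; exact h s hs

@[simp] lemma symProd_singleton (b x : ι) : symProd r b {x} = r x b := by
  simp [symProd_eq_sum b (Finset.singleton_nonempty x)]

/-- Two successive removals of elements of a finite set can be interchanged. -/
lemma sum_erase_comm {M : Type*} [AddCommMonoid M] (S : Finset ι) (f : ι → ι → M) :
    ∑ s ∈ S, ∑ i ∈ S.erase s, f s i = ∑ i ∈ S, ∑ s ∈ S.erase i, f s i :=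
  Finset.sum_comm' (by intro x y; simp only [Finset.mem_erase]; tauto)

/-- The recursion peels off first factors. Peeling off the first and, by induction, the last, and
exchanging the two choices, gives the mirror image; a singleton is separate because its two ends
coincide. -/
lemma symProd_eq_sum_right (b : ι) {S : Finset ι} (hS : S.Nonempty) :
    symProd r b S = ∑ a ∈ S, symProd r b (S.erase a) * r a b := by
  induction S using Finset.strongInduction with
  | H S ih =>
    by_cases h1 : ∃ x, S = {x}
    · obtain ⟨x, rfl⟩ := h1
      simp
    have hne : ∀ a ∈ S, (S.erase a).Nonempty := fun a ha => by
      rw [Finset.nonempty_iff_ne_empty]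
      intro h
      exact h1 ⟨a, by rw [← Finset.insert_erase ha, h]; rfl⟩
    rw [symProd_eq_sum b hS, Finset.sum_congr rfl fun a ha => by
      rw [ih _ (Finset.erase_ssubset ha) (hne a ha), Finset.mul_sum]]
    rw [sum_erase_comm]
    refine Finset.sum_congr rfl fun i hi => ?_
    rw [symProd_eq_sum b (hne i hi), Finset.sum_mul]
    refine Finset.sum_congr rfl fun a _ => ?_
    rw [Finset.erase_right_comm, mul_assoc]

lemma symProd_insert (b : ι) {S : Finset ι} {j : ι} (hj : j ∉ S) :
    symProd r b (insert j S) =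
      r j b * symProd r b S + ∑ s ∈ S, r s b * symProd r b (insert j (S.erase s)) := by
  rw [symProd_eq_sum b (Finset.insert_nonempty j S), Finset.sum_insert hj,
    Finset.erase_insert hj]
  congr 1
  refine Finset.sum_congr rfl fun s hs => ?_
  rw [Finset.erase_insert_of_ne (by rintro rfl; exact hj hs)]

namespace IsBracket

variable (h : IsBracket r c w)
include h

/-- The triple relation in the shape needed for words in brackets with a common second index. -/
lemma mul_eq {x u j : ι} (hxu : x ≠ u) (hxj : x ≠ j) (huj : u ≠ j) :
    r x j * r u j = r u x * r x j - r u j * r u x := by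
  have := h.triple x j u hxj huj.symm hxu
  rw [h.skew u j huj] at this
  rw [eq_sub_iff_add_eq, ← sub_eq_zero, ← neg_eq_zero, ← this]
  noncomm_ring

/-- The triple relation extended to words. Peel off the first factor and apply the induction
hypothesis behind it; the brackets `r i j` then move to the front, since they are disjoint from that
factor. -/
lemma symProd_insert_eq {S : Finset ι} {j b : ι} (hj : j ∉ S) (hb : b ∉ S) (hjb : j ≠ b) :
    symProd r b (insert j S) = symProd r b S * (r j b - ∑ i ∈ S, r i j) +
      ∑ i ∈ S, r i j * symProd r b (insert j (S.erase i)) := by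
  induction S using Finset.strongInduction with
  | H S ih =>
    rcases S.eq_empty_or_nonempty with rfl | hS
    · simp
    have hsj : ∀ s ∈ S, s ≠ j := fun s hs e => hj (e ▸ hs)
    have hsb : ∀ s ∈ S, s ≠ b := fun s hs e => hb (e ▸ hs)
    -- For S \ s the induction hypothesis subtracts only the `r i j` with i ≠ s; subtracting all of
    -- them leaves the correction `r s j`.
    have h1 : ∑ s ∈ S, r s b * symProd r b (insert j (S.erase s)) =
        ∑ s ∈ S, (r s b * symProd r b (S.erase s) * (r j b - ∑ i ∈ S, r i j) +
          r s b * symProd r b (S.erase s) * r s j) +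
        ∑ s ∈ S, ∑ i ∈ S.erase s,
          r s b * (r i j * symProd r b (insert j ((S.erase s).erase i))) := by
      rw [← Finset.sum_add_distrib]
      refine Finset.sum_congr rfl fun s hs => ?_
      rw [ih _ (Finset.erase_ssubset hs) (fun e => hj (Finset.mem_of_mem_erase e))
        (fun e => hb (Finset.mem_of_mem_erase e)), ← Finset.mul_sum, ← Finset.add_sum_erase _ _ hs]
      noncomm_ring
    have h2 : ∑ s ∈ S, ∑ i ∈ S.erase s,
          r s b * (r i j * symProd r b (insert j ((S.erase s).erase i))) =
        ∑ i ∈ S, r i j * (symProd r b (insert j (S.erase i)) - r j b * symProd r b (S.erase i)) := by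
      rw [sum_erase_comm]
      refine Finset.sum_congr rfl fun i hi => ?_
      rw [symProd_insert b (fun e => hj (Finset.mem_of_mem_erase e)), add_sub_cancel_left,
        Finset.mul_sum]
      refine Finset.sum_congr rfl fun s hs => ?_
      have hs' := Finset.mem_erase.1 hs
      rw [Finset.erase_right_comm, ← mul_assoc, ← mul_assoc,
        (h.comm s b i j (hsb s hs'.2) (hsj i hi) hs'.1 (hsj s hs'.2) (hsb i hi).symm
          hjb.symm).eq]
    -- The correction passes left to `r s b`, where the triple relation applies. Its two terms
    -- cancel the leading `r j b * symProd r b S` and the defect in `h2`.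
    have h3 : ∀ s ∈ S, r s b * symProd r b (S.erase s) * r s j =
        r s j * r j b * symProd r b (S.erase s) - r j b * (r s b * symProd r b (S.erase s)) := by
      intro s hs
      have hc : Commute (symProd r b (S.erase s)) (r s j) := symProd_commute fun t ht => by
        have ht' := Finset.mem_erase.1 ht
        exact h.comm t b s j (hsb t ht'.2) (hsj s hs) ht'.1 (hsj t ht'.2) (hsb s hs).symm hjb.symm
      rw [mul_assoc, hc.eq, ← mul_assoc, ← mul_assoc, h.mul_eq (hsj s hs).symm hjb (hsb s hs)]
      noncomm_ring
    rw [symProd_insert b hj, h1, h2, Finset.sum_add_distrib, Finset.sum_congr rfl h3,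
      Finset.sum_sub_distrib, ← Finset.sum_mul, ← Finset.mul_sum, ← symProd_eq_sum b hS]
    simp only [mul_sub, Finset.sum_sub_distrib, mul_assoc]
    abel

omit h in
lemma loopSum_insert (j : ι) {V : Finset ι} {x : ι} (hx : x ∉ V) :
    loopSum r j (insert x V) = r x j * symProd r j V * r x j +
      ∑ u ∈ V, r u j * symProd r j (insert x (V.erase u)) * r u j := by
  rw [loopSum, Finset.sum_insert hx, Finset.erase_insert hx]
  congr 1
  refine Finset.sum_congr rfl fun s hs => ?_
  rw [Finset.erase_insert_of_ne (by rintro rfl; exact hx hs)]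

/-- `symProd_insert_eq` inside the loop, with j as common index and x as new element. `V` must be
nonempty: for a loop on one element the right side vanishes while the left is a square. -/
lemma loopSum_insert_eq {V : Finset ι} {x j : ι} (hV : V.Nonempty) (hx : x ∉ V) (hj : j ∉ V)
    (hxj : x ≠ j) :
    loopSum r j (insert x V) = ∑ i ∈ V, r i x * loopSum r j (insert x (V.erase i)) -
      loopSum r j V * ∑ i ∈ V, r i x := by
  have hsj : ∀ s ∈ V, s ≠ j := fun s hs e => hj (e ▸ hs)
  have hsx : ∀ s ∈ V, s ≠ x := fun s hs e => hx (e ▸ hs)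
  set D := ∑ i ∈ V, r i x with hD
  have hcomm : ∀ u ∈ V, ∀ i ∈ V, i ≠ u → Commute (r i x) (r u j) := fun u hu i hi hiu =>
    h.comm i x u j (hsx i hi) (hsj u hu) hiu (hsj i hi) (hsx u hu).symm hxj
  have h1 : ∀ u ∈ V, r u j * symProd r j (insert x (V.erase u)) * r u j =
      r u x * r x j * symProd r j (V.erase u) * r x j -
        r x j * (r u j * symProd r j (V.erase u)) * r x j -
      r u j * symProd r j (V.erase u) * r u j * D +
      ∑ i ∈ V.erase u, r u j * (r i x * symProd r j (insert x ((V.erase u).erase i))) * r u j := by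
    intro u hu
    have hA : Commute (symProd r j (V.erase u)) (r u x) := symProd_commute fun t ht => by
      have ht' := Finset.mem_erase.1 ht
      exact (hcomm t ht'.2 u hu ht'.1.symm).symm
    have hDu : Commute (∑ i ∈ V.erase u, r i x) (r u j) :=
      Commute.sum_left _ _ _ fun i hi =>
        hcomm u hu i (Finset.mem_of_mem_erase hi) (Finset.ne_of_mem_erase hi)
    have hDe : D = r u x + ∑ i ∈ V.erase u, r i x := (Finset.add_sum_erase _ _ hu).symm
    rw [h.symProd_insert_eq (fun e => hx (Finset.mem_of_mem_erase e))
      (fun e => hj (Finset.mem_of_mem_erase e)) hxj, mul_add, add_mul, Finset.mul_sum,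
      Finset.sum_mul, hDe]
    congr 1
    set E := ∑ i ∈ V.erase u, r i x
    set P := symProd r j (V.erase u)
    have e1 := h.mul_eq (hsx u hu).symm hxj (hsj u hu)
    -- The closing `r u j` meets `r x j` and is rewritten by the triple relation; the resulting `r u
    -- x` passes through P to the opening `r u j`, where the relation is used again.
    calc r u j * (P * (r x j - E)) * r u j
        = r u j * P * (r x j * r u j) - r u j * P * (E * r u j) := by noncomm_ring
      _ = r u j * (P * r u x) * r x j - r u j * P * (r u j * r u x)
            - r u j * P * (r u j * E) := by rw [hDu.eq, e1]; noncomm_ring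
      _ = (r u x * r x j - r x j * r u j) * P * r x j
            - r u j * P * r u j * (r u x + E) := by rw [hA.eq, e1]; noncomm_ring
      _ = _ := by noncomm_ring
  have h2 : ∑ u ∈ V, ∑ i ∈ V.erase u,
      r u j * (r i x * symProd r j (insert x ((V.erase u).erase i))) * r u j =
      ∑ i ∈ V, r i x * (loopSum r j (insert x (V.erase i)) -
        r x j * symProd r j (V.erase i) * r x j) := by
    rw [sum_erase_comm]
    refine Finset.sum_congr rfl fun i hi => ?_
    rw [loopSum_insert j (fun e => hx (Finset.mem_of_mem_erase e)), add_sub_cancel_left,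
      Finset.mul_sum]
    refine Finset.sum_congr rfl fun u hu => ?_
    have hu' := Finset.mem_erase.1 hu
    rw [Finset.erase_right_comm, ← mul_assoc, ← (hcomm u hu'.2 i hi hu'.1.symm).eq]
    noncomm_ring
  rw [loopSum_insert j hx, Finset.sum_congr rfl h1, Finset.sum_add_distrib, h2,
    Finset.sum_sub_distrib, Finset.sum_sub_distrib, ← Finset.sum_mul, ← Finset.sum_mul,
    ← Finset.mul_sum, ← symProd_eq_sum j hV, ← Finset.sum_mul]
  simp only [mul_sub, Finset.sum_sub_distrib, ← mul_assoc, ← Finset.sum_mul]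
  rw [loopSum]
  abel

/-- Both sides satisfy the recursion `loopSum_insert_eq`, and for a single element the claim is the
square relation. -/
lemma loopSum_eq {U : Finset ι} {j : ι} (hj : j ∉ U) :
    loopSum r j U = ∑ u ∈ U, (c u j * symProd r u (U.erase u) -
      if U.erase u = ∅ then w u j else 0) := by
  induction U using Finset.strongInduction with
  | H U ih =>
    rcases U.eq_empty_or_nonempty with rfl | ⟨x, hxU⟩
    · simp [loopSum]
    obtain ⟨V, hx, rfl⟩ : ∃ V, x ∉ V ∧ U = insert x V :=
      ⟨U.erase x, Finset.notMem_erase x U, (Finset.insert_erase hxU).symm⟩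
    have hxj : x ≠ j := fun e => hj (e ▸ Finset.mem_insert_self _ _)
    have hjV : j ∉ V := fun e => hj (Finset.mem_insert_of_mem e)
    have hsx : ∀ s ∈ V, s ≠ x := fun s hs e => hx (e ▸ hs)
    rcases V.eq_empty_or_nonempty with rfl | hV
    · simp [loopSum, h.sq x j hxj]
    have hsj : ∀ s ∈ V, s ≠ j := fun s hs e => hjV (e ▸ hs)
    have hins : ∀ (S : Finset ι), S ⊆ V → ∀ u ∈ S, (insert x S).erase u = insert x (S.erase u) :=
      fun S hS u hu => Finset.erase_insert_of_ne (hsx u (hS hu)).symm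
    have hE : ∀ i ∈ V, loopSum r j (insert x (V.erase i)) =
        c x j * symProd r x (V.erase i) - (if V.erase i = ∅ then w x j else 0) +
          ∑ u ∈ V.erase i, c u j * symProd r u (insert x ((V.erase i).erase u)) := fun i hi => by
      rw [ih _ ⟨Finset.insert_subset_insert _ (Finset.erase_subset _ _), fun hh => ?_⟩
        (fun e => hj ((Finset.insert_subset_insert _ (Finset.erase_subset i V)) e)),
        Finset.sum_insert (fun e => hx (Finset.mem_of_mem_erase e)),
        Finset.erase_insert (fun e => hx (Finset.mem_of_mem_erase e))]
      · congr 1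
        refine Finset.sum_congr rfl fun u hu => ?_
        rw [hins _ (Finset.erase_subset _ _) u hu, if_neg (Finset.insert_ne_empty _ _), sub_zero]
      · have := hh (Finset.mem_insert_of_mem hi)
        simp [hsx i hi] at this
    have hVr := ih V (Finset.ssubset_insert hx) hjV
    rw [h.loopSum_insert_eq hV hx hjV hxj, hVr, Finset.sum_congr rfl fun i hi => by rw [hE i hi],
      Finset.sum_insert hx, Finset.erase_insert hx, if_neg hV.ne_empty, sub_zero]
    -- By skew symmetry `r x u` is the missing term -`r u x`, so `symProd_insert_eq` subtracts the
    -- sum over all of V, as the recursion requires.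
    have hR : ∑ u ∈ V, (c u j * symProd r u ((insert x V).erase u) -
        if (insert x V).erase u = ∅ then w u j else 0) =
        ∑ u ∈ V, c u j * (∑ i ∈ V.erase u, r i x * symProd r u (insert x ((V.erase i).erase u)) -
          symProd r u (V.erase u) * ∑ i ∈ V, r i x) := by
      refine Finset.sum_congr rfl fun u hu => ?_
      rw [hins V subset_rfl u hu, if_neg (Finset.insert_ne_empty _ _), sub_zero,
        h.symProd_insert_eq (fun e => hx (Finset.mem_of_mem_erase e)) (Finset.notMem_erase u V)
          (hsx u hu).symm, ← Finset.add_sum_erase _ _ hu, h.skew u x (hsx u hu)]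
      have he : ∀ i, (V.erase i).erase u = (V.erase u).erase i := fun i => Finset.erase_right_comm
      simp only [he]
      noncomm_ring
    -- Only V = {i} contributes, and there `r i x` carries `w x j` to `w i j`: the w-terms cancel
    -- for larger sets.
    have hW : ∑ i ∈ V, r i x * (if V.erase i = ∅ then w x j else 0) =
        (∑ u ∈ V, if V.erase u = ∅ then w u j else 0) * ∑ i ∈ V, r i x := by
      rw [Finset.sum_mul]
      refine Finset.sum_congr rfl fun i hi => ?_
      split_ifs with he
      · have hVi : V = {i} := by rw [← Finset.insert_erase hi, he]; rfl
        rw [hVi, Finset.sum_singleton, h.cross i x x j (hsx i hi), Equiv.swap_apply_right,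
          Equiv.swap_apply_of_ne_of_ne (hsj i hi).symm hxj.symm]
      · simp
    have hC : ∑ i ∈ V, r i x * (c x j * symProd r x (V.erase i)) = c x j * symProd r x V := by
      rw [symProd_eq_sum x hV, Finset.mul_sum]
      refine Finset.sum_congr rfl fun i _ => ?_
      rw [← mul_assoc, ← (h.c_comm x j (r i x)).eq, mul_assoc]
    have hS : ∑ i ∈ V, r i x *
          ∑ u ∈ V.erase i, c u j * symProd r u (insert x ((V.erase i).erase u)) =
        ∑ u ∈ V, c u j *
          ∑ i ∈ V.erase u, r i x * symProd r u (insert x ((V.erase i).erase u)) := by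
      simp only [Finset.mul_sum]
      rw [sum_erase_comm]
      refine Finset.sum_congr rfl fun i _ => Finset.sum_congr rfl fun u _ => ?_
      rw [← mul_assoc, ← (h.c_comm _ j (r _ x)).eq, mul_assoc]
    rw [hR]
    simp only [mul_add, mul_sub, Finset.sum_add_distrib, Finset.sum_sub_distrib, sub_mul]
    have hF : ∑ u ∈ V, c u j * (symProd r u (V.erase u) * ∑ i ∈ V, r i x) =
        (∑ u ∈ V, c u j * symProd r u (V.erase u)) * ∑ i ∈ V, r i x := by
      simp only [Finset.sum_mul, mul_assoc]
    rw [hC, hS, hW, hF]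
    abel

end IsBracket

lemma symProd_eq_add_ite (b : ι) (V : Finset ι) :
    symProd r b V = (∑ s ∈ V, r s b * symProd r b (V.erase s)) + if V = ∅ then 1 else 0 := by
  rcases V.eq_empty_or_nonempty with rfl | hV
  · simp
  · rw [if_neg hV.ne_empty, add_zero, ← symProd_eq_sum b hV]

lemma symProd_eq_add_ite_right (b : ι) (V : Finset ι) :
    symProd r b V = (∑ s ∈ V, symProd r b (V.erase s) * r s b) + if V = ∅ then 1 else 0 := by
  rcases V.eq_empty_or_nonempty with rfl | hV
  · simp
  · rw [if_neg hV.ne_empty, add_zero, ← symProd_eq_sum_right b hV]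

/-- Each word is cut just before its factor `r i b`; T \ i is divided into what precedes and what
follows. -/
lemma symProd_split (b : ι) {T : Finset ι} {i : ι} (hi : i ∈ T) :
    symProd r b T =
      setConv (symProd r b) (fun V => r i b * symProd r b V) (T.erase i) := by
  induction T using Finset.strongInduction with
  | H T ih =>
    rw [setConv_congr (fun V _ => symProd_eq_add_ite b V) (fun V _ => rfl), setConv_add_left,
      setConv_ite_empty_left, one_mul,
      setConv_sum_left (fun s V => r s b * symProd r b V), symProd_eq_sum b ⟨i, hi⟩,
      ← Finset.add_sum_erase _ _ hi, add_comm]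
    congr 1
    refine Finset.sum_congr rfl fun s hs => ?_
    have hs' := Finset.mem_erase.1 hs
    rw [ih _ (Finset.erase_ssubset hs'.2) (Finset.mem_erase.2 ⟨hs'.1.symm, hi⟩), mul_setConv,
      Finset.erase_right_comm]

/-- The appended `r i j` repeats a factor of the word. Cutting at the earlier occurrence leaves a
prefix followed by a loop. -/
lemma sum_symProd_mul (j : ι) (T : Finset ι) :
    ∑ i ∈ T, symProd r j T * r i j = setConv (symProd r j) (loopSum r j) T := by
  unfold loopSum
  rw [setConv_sum_right (symProd r j) (fun u V => r u j * symProd r j V * r u j)]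
  refine Finset.sum_congr rfl fun i hi => ?_
  rw [symProd_split j hi, setConv_mul_right]

end Bracket

end EllipticFK

namespace EllipticFK

/-! ### The recursion for the Pieri sums. -/

section Bracket

variable {ι R : Type*} [LinearOrder ι] [Ring R] {r c w : ι → ι → R}

/-- Since second indices increase weakly, the factors with the least one form an initial segment. -/
lemma fullSum_insert_min {K : Finset ι} {b : ι} (hb : ∀ k ∈ K, b < k) (S : Finset ι) :
    fullSum r (insert b K) S = setConv (symProd r b) (fullSum r K) S := by
  have hbK : b ∉ K := fun e => lt_irrefl _ (hb b e)
  induction S using Finset.strongInduction with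
  | H S ih =>
    rcases S.eq_empty_or_nonempty with rfl | hS
    · simp
    have h1 : (insert b K).filter (b ≤ ·) = insert b K := Finset.filter_true_of_mem fun k hk => by
      rcases Finset.mem_insert.1 hk with rfl | hk
      · exact le_rfl
      · exact (hb k hk).le
    have h2 : ∀ k ∈ K, (insert b K).filter (k ≤ ·) = K.filter (k ≤ ·) := fun k hk => by
      rw [Finset.filter_insert, if_neg (not_le.2 (hb k hk))]
    rw [setConv_congr (fun V _ => symProd_eq_add_ite b V) (fun V _ => rfl), setConv_add_left,
      setConv_ite_empty_left, one_mul,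
      setConv_sum_left (fun s V => r s b * symProd r b V), fullSum_eq_sum _ hS,
      fullSum_eq_sum _ hS, ← Finset.sum_add_distrib]
    refine Finset.sum_congr rfl fun a ha => ?_
    rw [Finset.sum_insert hbK, h1, ih _ (Finset.erase_ssubset ha), mul_setConv]
    congr 1
    exact Finset.sum_congr rfl fun k hk => by rw [h2 k hk]

namespace IsBracket

variable (h : IsBracket r c w)
include h

lemma symProd_commute_symProd {a b : ι} {S T : Finset ι} (hST : Disjoint S T) (hab : a ≠ b)
    (haS : a ∉ S) (haT : a ∉ T) (hbS : b ∉ S) (hbT : b ∉ T) :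
    Commute (symProd r a S) (symProd r b T) :=
  symProd_commute fun s hs => (symProd_commute fun t ht =>
    (h.comm t b s a (fun e => hbT (e ▸ ht)) (fun e => haS (e ▸ hs))
      (fun e => Finset.disjoint_left.1 hST hs (e ▸ ht)) (fun e => haT (e ▸ ht))
      (fun e => hbS (e ▸ hs)) hab.symm)).symm

/-- The order of second indices is immaterial: the factor of the least index is pulled out, and the
commuting symmetrized products are exchanged. -/
lemma fullSum_insert {K : Finset ι} {b : ι} (hb : b ∉ K) {W : Finset ι}
    (hW : Disjoint W (insert b K)) :
    fullSum r (insert b K) W = setConv (symProd r b) (fullSum r K) W := by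
  induction K using Finset.induction_on_min generalizing b W with
  | empty => exact fullSum_insert_min (by simp) W
  | insert m K hm ih =>
    rcases lt_or_ge b m with hbm | hbm
    · refine fullSum_insert_min (fun k hk => ?_) W
      rcases Finset.mem_insert.1 hk with rfl | hk
      · exact hbm
      · exact hbm.trans (hm k hk)
    have hmb : m < b := lt_of_le_of_ne hbm fun e => hb (e ▸ Finset.mem_insert_self _ _)
    have hbK : b ∉ K := fun e => hb (Finset.mem_insert_of_mem e)
    rw [Finset.insert_comm] at hW
    have hW' := (Finset.disjoint_insert_right.1 hW).2
    have hbW := (Finset.disjoint_insert_right.1 hW').1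
    have hmW := (Finset.disjoint_insert_right.1 hW).1
    rw [Finset.insert_comm, fullSum_insert_min (fun k hk => by
        rcases Finset.mem_insert.1 hk with rfl | hk
        exacts [hmb, hm k hk]) W,
      setConv_congr (fun _ _ => rfl) (fun T hT => ih hbK (Finset.disjoint_of_subset_left hT hW')),
      setConv_congr (f := symProd r b) (fun _ _ => rfl) (fun T _ => fullSum_insert_min hm T),
      ← setConv_assoc, ← setConv_assoc]
    refine setConv_congr (fun T hT => setConv_comm fun V hV => ?_) (fun _ _ => rfl)
    exact h.symProd_commute_symProd Finset.disjoint_sdiff hmb.ne (fun e => hmW (hT (hV e)))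
      (fun e => hmW (hT (Finset.sdiff_subset e))) (fun e => hbW (hT (hV e)))
      (fun e => hbW (hT (Finset.sdiff_subset e)))

lemma fullSum_commute_bracket {K S : Finset ι} {i j : ι} (hKS : Disjoint S K) (hij : i ≠ j)
    (hiS : i ∉ S) (hiK : i ∉ K) (hjS : j ∉ S) (hjK : j ∉ K) :
    Commute (fullSum r K S) (r i j) :=
  fullSum_commute fun s hs b hb => h.comm s b i j
    (fun e => Finset.disjoint_left.1 hKS hs (e ▸ hb)) hij (fun e => hiS (e ▸ hs))
    (fun e => hjS (e ▸ hs)) (fun e => hiK (e ▸ hb)) (fun e => hjK (e ▸ hb))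

/-- `symProd_insert_eq` adds up over K: j joins either the part of the new index or the rest, and
the brackets of one part commute with the other part. -/
lemma fullSum_insert_eq {K S : Finset ι} {j : ι} (hjK : j ∉ K) (hjS : j ∉ S)
    (hKS : Disjoint S K) :
    fullSum r K (insert j S) = fullSum r K S * (∑ b ∈ K, r j b - ∑ i ∈ S, r i j) +
      ∑ i ∈ S, r i j * fullSum r K (insert j (S.erase i)) := by
  induction K using Finset.induction_on generalizing S with
  | empty =>
    have h0 : ∀ T : Finset ι, fullSum r ∅ (insert j T) = 0 := fun T =>
      fullSum_empty_left (Finset.insert_nonempty j T)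
    rcases S.eq_empty_or_nonempty with rfl | hS
    · simpa using h0 ∅
    · simp [h0, fullSum_empty_left hS]
  | insert b K hbK ih =>
    have hjb : j ≠ b := fun e => hjK (e ▸ Finset.mem_insert_self _ _)
    have hjK' : j ∉ K := fun e => hjK (Finset.mem_insert_of_mem e)
    obtain ⟨hbS, hKS'⟩ := Finset.disjoint_insert_right.1 hKS
    have hF : ∀ T ⊆ S, fullSum r (insert b K) (insert j T) =
        setConv (symProd r b) (fun V => fullSum r K (insert j V)) T +
          setConv (fun V => symProd r b (insert j V)) (fullSum r K) T := fun T hT => by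
      rw [h.fullSum_insert hbK (Finset.disjoint_insert_left.2
        ⟨hjK, Finset.disjoint_of_subset_left hT hKS⟩), setConv_insert _ _ fun e => hjS (hT e)]
    have hFe : ∑ i ∈ S, r i j * fullSum r (insert b K) (insert j (S.erase i)) =
        ∑ i ∈ S, r i j * setConv (symProd r b) (fun V => fullSum r K (insert j V)) (S.erase i) +
        ∑ i ∈ S, r i j *
          setConv (fun V => symProd r b (insert j V)) (fullSum r K) (S.erase i) := by
      rw [← Finset.sum_add_distrib]
      exact Finset.sum_congr rfl fun i _ => by rw [hF _ (Finset.erase_subset i S), mul_add]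
    rw [hF S subset_rfl, hFe]
    have h1 : setConv (symProd r b) (fun V => fullSum r K (insert j V)) S =
        setConv (symProd r b) (fun V => fullSum r K V * (∑ b ∈ K, r j b - ∑ i ∈ V, r i j)) S +
        ∑ i ∈ S, r i j *
          setConv (symProd r b) (fun V => fullSum r K (insert j V)) (S.erase i) := by
      rw [setConv_congr (fun _ _ => rfl) fun T hT => ih hjK' (fun e => hjS (hT e))
        (Finset.disjoint_of_subset_left hT hKS'), setConv_add_right,
        setConv_sum_right _ fun i V => r i j * fullSum r K (insert j V)]
      congr 1
      refine Finset.sum_congr rfl fun i hi => ?_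
      rw [mul_setConv_commute _ _ _ _ fun T hT => (symProd_commute fun t ht => ?_).symm]
      have ht' := Finset.mem_erase.1 (hT ht)
      exact h.comm t b i j (fun e => hbS (e ▸ ht'.2)) (fun e => hjS (e ▸ hi)) ht'.1
        (fun e => hjS (e ▸ ht'.2)) (fun e => hbS (e ▸ hi)) hjb.symm
    have h2 : setConv (fun V => symProd r b (insert j V)) (fullSum r K) S =
        setConv (fun V => symProd r b V * (r j b - ∑ i ∈ V, r i j)) (fullSum r K) S +
        ∑ i ∈ S, r i j *
          setConv (fun V => symProd r b (insert j V)) (fullSum r K) (S.erase i) := by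
      rw [setConv_congr (fun T hT => h.symProd_insert_eq (fun e => hjS (hT e))
        (fun e => hbS (hT e)) hjb) fun _ _ => rfl, setConv_add_left,
        setConv_sum_left fun i V => r i j * symProd r b (insert j V)]
      congr 1
      exact Finset.sum_congr rfl fun i _ => (mul_setConv _ _ _ _).symm
    have h3 : setConv (symProd r b) (fun V => fullSum r K V *
          (∑ b ∈ K, r j b - ∑ i ∈ V, r i j)) S +
        setConv (fun V => symProd r b V * (r j b - ∑ i ∈ V, r i j)) (fullSum r K) S =
        fullSum r (insert b K) S * (∑ b ∈ insert b K, r j b - ∑ i ∈ S, r i j) := by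
      rw [h.fullSum_insert hbK hKS, setConv, setConv, setConv, Finset.sum_mul,
        ← Finset.sum_add_distrib, Finset.sum_insert hbK]
      refine Finset.sum_congr rfl fun T hT => ?_
      have hTS := Finset.mem_powerset.1 hT
      have hd : Disjoint (S \ T) K := Finset.disjoint_of_subset_left Finset.sdiff_subset hKS'
      have hj' : j ∉ S \ T := fun e => hjS (Finset.sdiff_subset e)
      have hc : Commute (fullSum r K (S \ T)) (r j b - ∑ i ∈ T, r i j) := by
        refine Commute.sub_right (h.fullSum_commute_bracket hd hjb hj' hjK'
          (fun e => hbS (Finset.sdiff_subset e)) hbK) (Commute.sum_right _ _ _ fun i hi => ?_)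
        exact h.fullSum_commute_bracket hd (fun e => hjS (e ▸ hTS hi))
          (fun e => (Finset.mem_sdiff.1 e).2 hi)
          (fun e => Finset.disjoint_left.1 hKS' (hTS hi) e) hj' hjK'
      rw [mul_assoc, ← hc.eq, ← Finset.sum_sdiff hTS]
      noncomm_ring
    rw [h1, h2, ← h3]
    abel

/-- A telescoping sum: a bracket `r i j` at the end of the `symProd` factor cancels the same bracket
at the front of the `fullSum` factor. -/
lemma setConv_symProd_fullSum {K W : Finset ι} {j : ι} (hjK : j ∉ K) (hjW : j ∉ W)
    (hKW : Disjoint W K) :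
    setConv (symProd r j) (fun S => fullSum r K S * (∑ b ∈ K, r j b - ∑ i ∈ S, r i j)) W =
      fullSum r K (insert j W) := by
  rw [setConv_congr (fun _ _ => rfl) fun T hT =>
      eq_sub_of_add_eq (h.fullSum_insert_eq hjK (fun e => hjW (hT e))
        (Finset.disjoint_of_subset_left hT hKW)).symm,
    setConv_sub_right, setConv_sum_right _ fun i V => r i j * fullSum r K (insert j V),
    setConv_congr (g := fun T => fullSum r K (insert j T))
      (fun V _ => symProd_eq_add_ite_right j V) (fun V _ => rfl), setConv_add_left,
    setConv_ite_empty_left, one_mul, setConv_sum_left fun s V => symProd r j V * r s j]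
  simp only [setConv, mul_assoc]
  abel

lemma setConv_symProd_fullSum_eq {K W : Finset ι} {j : ι} (hjK : j ∉ K) (hjW : j ∉ W)
    (hKW : Disjoint W K) :
    setConv (symProd r j) (fullSum r K) W = fullSum r K W +
      ∑ i ∈ W, setConv (symProd r j) (fullSum r K) (W.erase i) * r i j := by
  rw [setConv_congr (fun V _ => symProd_eq_add_ite_right j V) (fun V _ => rfl), setConv_add_left,
    setConv_ite_empty_left, one_mul, setConv_sum_left fun s V => symProd r j V * r s j, add_comm]
  congr 1
  refine Finset.sum_congr rfl fun i hi => ?_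
  refine (setConv_mul_commute _ _ _ _ fun T hT => ?_).symm
  have hT' : T ⊆ W := hT.trans (Finset.erase_subset _ _)
  exact h.fullSum_commute_bracket (Finset.disjoint_of_subset_left hT' hKW)
    (fun e => hjW (e ▸ hi)) (fun e => Finset.notMem_erase _ _ (hT e))
    (fun e => Finset.disjoint_left.1 hKW hi e) (fun e => hjW (hT' e)) hjK

/-- The last factor `r v j` turns `w i j` into `w i v`, which the other factors fix because they
involve neither i nor v. -/
lemma symProd_mul_w {V : Finset ι} {i j : ι} (hj : j ∉ V) (hi : i ∉ V) (hij : i ≠ j) :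
    symProd r j V * w i j = (∑ v ∈ V, w i v * (symProd r j (V.erase v) * r v j)) +
      if V = ∅ then w i j else 0 := by
  rw [symProd_eq_add_ite_right, add_mul, Finset.sum_mul, ite_mul, one_mul, zero_mul]
  congr 1
  refine Finset.sum_congr rfl fun v hv => ?_
  have hvi : i ≠ v := fun e => hi (e ▸ hv)
  have hvj : v ≠ j := fun e => hj (e ▸ hv)
  have hc : Commute (symProd r j (V.erase v)) (w i v) := symProd_commute fun t ht => by
    have ht' := Finset.mem_erase.1 ht
    have htj : t ≠ j := fun e => hj (e ▸ ht'.2)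
    have := h.cross t j i v htj
    rwa [Equiv.swap_apply_of_ne_of_ne (show i ≠ t from fun e => hi (e ▸ ht'.2)) hij,
      Equiv.swap_apply_of_ne_of_ne ht'.1.symm hvj] at this
  rw [mul_assoc, h.cross v j i j hvj, Equiv.swap_apply_of_ne_of_ne hvi hij,
    Equiv.swap_apply_right, ← mul_assoc, hc.eq, mul_assoc]

/-- Moving the brackets `[ij]`, `i ∈ W`, through the product of a hafnian `φ` of `w` and a
symmetrized product. -/
lemma setConv_hafnian_symProd_mul {φ : Finset ι → R}
    (hφ : ∀ S, ∀ v ∈ S, φ S = ∑ i ∈ S.erase v, w i v * φ ((S.erase v).erase i))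
    (hφw : ∀ S i j, Commute (φ S) (w i j)) {W : Finset ι} {j : ι} (hj : j ∉ W) :
    setConv φ (symProd r j) W * ∑ i ∈ W, r i j =
      ∑ i ∈ W, (c i j * setConv (setConv φ (symProd r j)) (symProd r i) (W.erase i) -
        w i j * φ (W.erase i)) := by
  have hne : ∀ i ∈ W, i ≠ j := fun i hi e => hj (e ▸ hi)
  -- The bracket is indexed either by an element already matched in φ or by one in the word, where
  -- it closes a loop.
  have h1 : setConv φ (symProd r j) W * ∑ i ∈ W, r i j =
      ∑ T ∈ W.powerset, ∑ i ∈ T, φ T * (symProd r j (W \ T) * r i j) +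
        setConv φ (fun T => ∑ i ∈ T, symProd r j T * r i j) W := by
    rw [setConv, setConv, Finset.sum_mul, ← Finset.sum_add_distrib]
    refine Finset.sum_congr rfl fun T hT => ?_
    rw [← Finset.sum_sdiff (Finset.mem_powerset.1 hT), ← Finset.mul_sum, ← Finset.mul_sum,
      ← Finset.mul_sum]
    noncomm_ring
  have h2 : ∑ T ∈ W.powerset, ∑ i ∈ T, φ T * (symProd r j (W \ T) * r i j) =
      ∑ i ∈ W, ∑ v ∈ W.erase i,
        setConv (fun T => w i v * φ T) (fun V => symProd r j V * r v j) ((W.erase i).erase v) := by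
    rw [Finset.sum_congr rfl fun T _ => Finset.sum_congr rfl fun v hv => by rw [hφ T v hv]]
    rw [sum_powerset_sum_mem W fun v T U =>
      (∑ i ∈ T, w i v * φ (T.erase i)) * (symProd r j U * r v j), ← sum_erase_comm]
    refine Finset.sum_congr rfl fun v _ => ?_
    have he : ∀ i, (W.erase i).erase v = (W.erase v).erase i := fun i => Finset.erase_right_comm
    simp only [he]
    exact setConv_sum_left (fun i T => w i v * φ T) (fun V => symProd r j V * r v j) _
  have h3 : ∀ T ⊆ W, ∑ i ∈ T, symProd r j T * r i j =
      ∑ i ∈ T, (c i j * setConv (symProd r j) (symProd r i) (T.erase i) -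
        symProd r j (T.erase i) * w i j) := fun T hT => by
    rw [sum_symProd_mul, setConv_congr (fun _ _ => rfl) fun U hU =>
      h.loopSum_eq (fun e => hj (hT (hU e))), setConv_sum_right (symProd r j) fun u U =>
        c u j * symProd r u U - if U = ∅ then w u j else 0]
    refine Finset.sum_congr rfl fun i _ => ?_
    rw [setConv_sub_right, setConv_ite_empty_right,
      mul_setConv_commute _ _ _ _ fun _ _ => h.c_comm _ _ _]
  -- The loop corrections, moved left through the word, contain exactly the terms of `h2` with
  -- opposite sign.
  have h4 : setConv φ (fun T => ∑ i ∈ T, symProd r j T * r i j) W =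
      ∑ i ∈ W, (c i j * setConv (setConv φ (symProd r j)) (symProd r i) (W.erase i) -
        (w i j * φ (W.erase i) + ∑ v ∈ W.erase i, setConv (fun T => w i v * φ T)
          (fun V => symProd r j V * r v j) ((W.erase i).erase v))) := by
    rw [setConv_congr (fun _ _ => rfl) h3, setConv_sum_right φ fun i T =>
      c i j * setConv (symProd r j) (symProd r i) T - symProd r j T * w i j]
    refine Finset.sum_congr rfl fun i hi => ?_
    rw [setConv_sub_right, ← mul_setConv_commute _ _ _ _ fun _ _ => h.c_comm _ _ _, setConv_assoc]
    congr 1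
    rw [setConv_congr (fun _ _ => rfl) fun T hT =>
      h.symProd_mul_w (fun e => hj (Finset.mem_of_mem_erase (hT e)))
        (fun e => Finset.notMem_erase _ _ (hT e)) (hne i hi), setConv_add_right,
      setConv_ite_empty_right, (hφw _ i j).eq,
      setConv_sum_right φ fun v V => w i v * (symProd r j V * r v j), add_comm]
    congr 1
    refine Finset.sum_congr rfl fun v _ => Finset.sum_congr rfl fun T _ => ?_
    rw [← mul_assoc, (hφw _ _ _).eq]
  rw [h1, h2, h4]
  simp only [Finset.sum_sub_distrib, Finset.sum_add_distrib]
  abel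

/-- This compares, for one set W, the terms left in the recursion. Brackets indexed by the `fullSum`
part telescope; those indexed by the other two parts give the c-terms and the hafnian expansion
along j. -/
lemma setConv_hafnian_mul {φ : Finset ι → R}
    (hφ : ∀ S, ∀ v ∈ S, φ S = ∑ i ∈ S.erase v, w i v * φ ((S.erase v).erase i))
    (hφw : ∀ S i j, Commute (φ S) (w i j)) {K W : Finset ι} {j : ι} (hjK : j ∉ K) (hj : j ∉ W)
    (hKW : Disjoint W K) :
    setConv φ (setConv (symProd r j) (fullSum r K)) W * (∑ b ∈ K, r j b - ∑ i ∈ W, r i j) +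
      ∑ i ∈ W, c i j *
        setConv φ (setConv (symProd r j) (setConv (symProd r i) (fullSum r K))) (W.erase i) =
      setConv φ (fullSum r K) (insert j W) := by
  have h1 : setConv φ (setConv (symProd r j) (fullSum r K)) W *
      (∑ b ∈ K, r j b - ∑ i ∈ W, r i j) =
      setConv φ (fun T => fullSum r K (insert j T)) W -
        setConv (fun T => setConv φ (symProd r j) T * ∑ i ∈ T, r i j) (fullSum r K) W := by
    rw [setConv_congr (f := φ) (g := fun T => fullSum r K (insert j T)) (fun _ _ => rfl)
      fun T hT => (h.setConv_symProd_fullSum hjK (fun e => hj (hT e))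
        (Finset.disjoint_of_subset_left hT hKW)).symm, ← setConv_assoc, ← setConv_assoc, setConv,
      Finset.sum_mul, setConv, setConv, ← Finset.sum_sub_distrib]
    refine Finset.sum_congr rfl fun T hT => ?_
    have hTW := Finset.mem_powerset.1 hT
    have hc : Commute (fullSum r K (W \ T)) (∑ i ∈ T, r i j) :=
      Commute.sum_right _ _ _ fun i hi => h.fullSum_commute_bracket
        (Finset.disjoint_of_subset_left Finset.sdiff_subset hKW) (fun e => hj (e ▸ hTW hi))
          (fun e => (Finset.mem_sdiff.1 e).2 hi)
          (fun e => Finset.disjoint_left.1 hKW (hTW hi) e)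
          (fun e => hj (Finset.sdiff_subset e)) hjK
    rw [mul_assoc _ (∑ i ∈ T, r i j), ← hc.eq, ← Finset.sum_sdiff hTW]
    noncomm_ring
  rw [h1, setConv_congr (fun T hT => h.setConv_hafnian_symProd_mul hφ hφw fun e => hj (hT e))
    fun _ _ => rfl, setConv_sum_left fun i T =>
      c i j * setConv (setConv φ (symProd r j)) (symProd r i) T - w i j * φ T,
    setConv_insert _ _ hj, setConv_congr (f := fun T => φ (insert j T)) (fun T hT => by
      rw [hφ (insert j T) j (Finset.mem_insert_self _ _),
        Finset.erase_insert fun e => hj (hT e)]) fun _ _ => rfl,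
    setConv_sum_left fun i T => w i j * φ T]
  have ha : ∀ f g g' : Finset ι → R, setConv (setConv f g) g' = setConv f (setConv g g') :=
    fun f g g' => funext (setConv_assoc f g g')
  simp only [setConv_sub_left, ← mul_setConv, ha, Finset.sum_sub_distrib]
  abel

end IsBracket

variable [Fintype ι]

/-- The right-hand side of the Pieri formula, for a function `φ` in place of the hafnian. -/
def pieriRHS (r : ι → ι → R) (φ : Finset ι → R) (k : ℕ) (I : Finset ι) : R :=
  ∑ W ∈ I.powersetCard k, setConv φ (fullSum r Iᶜ) W

/-- The `if` encodes E_{-1} = 0, which truncated subtraction would replace by E_0. -/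
lemma IsBracket.pieriRHS_insert (h : IsBracket r c w) {φ : Finset ι → R}
    (hφ : ∀ S, ∀ v ∈ S, φ S = ∑ i ∈ S.erase v, w i v * φ ((S.erase v).erase i))
    (hφw : ∀ S i j, Commute (φ S) (w i j)) (k : ℕ) {I : Finset ι} {j : ι} (hj : j ∉ I) :
    pieriRHS r φ (k + 1) (insert j I) = pieriRHS r φ (k + 1) I +
      pieriRHS r φ k I * ∑ i ∈ Finset.univ.erase j, r j i +
      ∑ i ∈ I, c i j * (if k = 0 then 0 else pieriRHS r φ (k - 1) (I.erase i)) := by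
  set K := (insert j I)ᶜ with hK
  have hjK : j ∉ K := by simp [hK]
  have hIc : Iᶜ = insert j K := by
    ext y
    by_cases hy : y = j <;> simp [hK, hy, hj]
  have hIK : Disjoint I K := by
    rw [hK, Finset.disjoint_left]
    intro y hy
    simp [hy]
  have hI : ∀ W ⊆ I, setConv φ (fullSum r Iᶜ) W =
      setConv φ (setConv (symProd r j) (fullSum r K)) W := fun W hW => by
    rw [hIc]
    refine setConv_congr (fun _ _ => rfl) fun T hT => h.fullSum_insert hjK ?_
    exact Finset.disjoint_insert_right.2 ⟨fun e => hj (hW (hT e)),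
      Finset.disjoint_of_subset_left (hT.trans hW) hIK⟩
  have hθ : ∑ i ∈ Finset.univ.erase j, r j i = ∑ b ∈ K, r j b - ∑ i ∈ I, r i j := by
    have : Finset.univ.erase j = K ∪ I := by
      ext y
      by_cases hy : y = j <;> by_cases hy' : y ∈ I <;> simp [hK, hy, hy', hj]
    rw [this, Finset.sum_union hIK.symm, sub_eq_add_neg, ← Finset.sum_neg_distrib]
    congr 1
    exact Finset.sum_congr rfl fun i hi => h.skew i j fun e => hj (e ▸ hi)
  have h1 : pieriRHS r φ (k + 1) (insert j I) =
      ∑ W ∈ I.powersetCard (k + 1), setConv φ (fullSum r K) W +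
      ∑ W ∈ I.powersetCard k, setConv φ (fullSum r K) (insert j W) := by
    rw [pieriRHS, Finset.powersetCard_succ_insert hj, Finset.sum_union, Finset.sum_image]
    · intro A hA B hB hAB
      have hjA : j ∉ A := fun e => hj ((Finset.mem_powersetCard.1 hA).1 e)
      have hjB : j ∉ B := fun e => hj ((Finset.mem_powersetCard.1 hB).1 e)
      rw [← Finset.erase_insert hjA, hAB, Finset.erase_insert hjB]
    · rw [Finset.disjoint_left]
      intro A hA hA'
      obtain ⟨B, -, rfl⟩ := Finset.mem_image.1 hA'
      exact hj ((Finset.mem_powersetCard.1 hA).1 (Finset.mem_insert_self _ _))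
  -- Splitting off the last `r i j` and regrouping by the remaining set W produces the terms i ∈ I \
  -- W that cancel against the product with θ_j.
  have h2 : pieriRHS r φ (k + 1) I =
      ∑ W ∈ I.powersetCard (k + 1), setConv φ (fullSum r K) W +
      ∑ W ∈ I.powersetCard k, ∑ i ∈ I \ W,
        setConv φ (setConv (symProd r j) (fullSum r K)) W * r i j := by
    rw [sum_powersetCard_sum_sdiff k I fun i W =>
        setConv φ (setConv (symProd r j) (fullSum r K)) W * r i j,
      ← sum_powersetCard_sum_mem, ← Finset.sum_add_distrib, pieriRHS]
    refine Finset.sum_congr rfl fun W hW => ?_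
    have hWI := (Finset.mem_powersetCard.1 hW).1
    rw [hI W hWI, setConv_congr (fun _ _ => rfl) fun T hT =>
      h.setConv_symProd_fullSum_eq hjK (fun e => hj (hWI (hT e)))
        (Finset.disjoint_of_subset_left (hT.trans hWI) hIK), setConv_add_right,
      setConv_sum_right φ fun i T => setConv (symProd r j) (fullSum r K) T * r i j]
    simp only [← setConv_mul_right]
  have h3 : ∑ i ∈ I, c i j * (if k = 0 then 0 else pieriRHS r φ (k - 1) (I.erase i)) =
      ∑ W ∈ I.powersetCard k, ∑ i ∈ W, c i j *
        setConv φ (setConv (symProd r j) (setConv (symProd r i) (fullSum r K))) (W.erase i) := by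
    cases k with
    | zero => simp
    | succ k =>
      rw [sum_powersetCard_sum_mem k I fun i W => c i j *
        setConv φ (setConv (symProd r j) (setConv (symProd r i) (fullSum r K))) W]
      refine Finset.sum_congr rfl fun i hi => ?_
      rw [if_neg (Nat.succ_ne_zero k), Nat.add_sub_cancel, pieriRHS, Finset.mul_sum]
      refine Finset.sum_congr rfl fun W hW => ?_
      have hWI := (Finset.mem_powersetCard.1 hW).1
      have hji : j ≠ i := fun e => hj (e ▸ hi)
      have hiK : i ∉ K := Finset.disjoint_left.1 hIK hi
      have hc : (I.erase i)ᶜ = insert j (insert i K) := by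
        rw [Finset.compl_erase, hIc, Finset.insert_comm]
      have hd : ∀ T ⊆ W, Disjoint T (insert i K) := fun T hT =>
        Finset.disjoint_insert_right.2 ⟨fun e => Finset.notMem_erase _ _ (hWI (hT e)),
          Finset.disjoint_of_subset_left ((hT.trans hWI).trans (Finset.erase_subset _ _)) hIK⟩
      congr 1
      refine setConv_congr (fun _ _ => rfl) fun T hT => ?_
      rw [hc, h.fullSum_insert (by simp [hji, hjK]) (Finset.disjoint_insert_right.2
        ⟨fun e => hj (Finset.mem_of_mem_erase (hWI (hT e))), hd T hT⟩)]
      exact setConv_congr (fun _ _ => rfl) fun V hV => h.fullSum_insert hiK (hd V (hV.trans hT))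
  have h4 : pieriRHS r φ k I =
      ∑ W ∈ I.powersetCard k, setConv φ (setConv (symProd r j) (fullSum r K)) W :=
    Finset.sum_congr rfl fun W hW => hI W (Finset.mem_powersetCard.1 hW).1
  rw [h1, h2, h3, h4, hθ, add_assoc, add_assoc, Finset.sum_mul, ← Finset.sum_add_distrib,
    ← Finset.sum_add_distrib]
  congr 1
  refine Finset.sum_congr rfl fun W hW => ?_
  have hWI := (Finset.mem_powersetCard.1 hW).1
  rw [← h.setConv_hafnian_mul hφ hφw hjK (fun e => hj (hWI e))
    (Finset.disjoint_of_subset_left hWI hIK), ← Finset.sum_sdiff hWI, ← Finset.mul_sum]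
  noncomm_ring

end Bracket

end EllipticFK

namespace EllipticFK

/-! ### Hafnians and sums over sequences -/

section Hafnian

variable {ι M : Type*} [LinearOrder ι] [CommRing M]

/-- A hafnian, defined by expansion along the least index, can be expanded along any index. -/
lemma hafnian_expand {w : ι → ι → M} (hw : ∀ i j, w i j = w j i) {φ : Finset ι → M}
    (hφ : ∀ S, ∀ m ∈ S, (∀ x ∈ S, m ≤ x) →
      φ S = ∑ i ∈ S.erase m, w m i * φ ((S.erase m).erase i))
    (S : Finset ι) (v : ι) (hv : v ∈ S) :
    φ S = ∑ i ∈ S.erase v, w i v * φ ((S.erase v).erase i) := by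
  induction S using Finset.strongInduction with
  | H S ih =>
    have hm := S.min'_mem ⟨v, hv⟩
    have hle : ∀ x ∈ S, S.min' ⟨v, hv⟩ ≤ x := fun x hx => Finset.min'_le _ _ hx
    generalize S.min' ⟨v, hv⟩ = m at hm hle
    rw [hφ S m hm hle]
    rcases eq_or_ne v m with rfl | hvm
    · exact Finset.sum_congr rfl fun i _ => by rw [hw]
    rw [← Finset.add_sum_erase _ _ (Finset.mem_erase.2 ⟨hvm, hv⟩),
      ← Finset.add_sum_erase (S.erase v) _ (Finset.mem_erase.2 ⟨hvm.symm, hm⟩),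
      Finset.erase_right_comm (a := v) (b := m)]
    -- The matchings containing the pair {m, v} agree. In the others m and v have different partners
    -- p and i, and expanding twice gives double sums differing only in order.
    congr 1
    set U := (S.erase m).erase v with hU
    have hUmem : ∀ {p}, p ∈ U ↔ p ≠ v ∧ p ≠ m ∧ p ∈ S := by simp [hU]
    have h1 : ∀ p ∈ U, w m p * φ ((S.erase m).erase p) =
        ∑ i ∈ U.erase p, w m p * (w i v * φ ((U.erase p).erase i)) := fun p hp => by
      obtain ⟨hpv, hpm, hpS⟩ := hUmem.1 hp
      have hs : (S.erase m).erase p ⊂ S :=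
        (Finset.erase_ssubset (Finset.mem_erase.2 ⟨hpm, hpS⟩)).trans (Finset.erase_ssubset hm)
      rw [ih _ hs (by simp [hpv.symm, hvm, hv]), Finset.mul_sum,
        Finset.erase_right_comm (a := p) (b := v)]
    have h2 : ∀ i ∈ U, w i v * φ ((S.erase v).erase i) =
        ∑ p ∈ U.erase i, w m p * (w i v * φ ((U.erase p).erase i)) := fun i hi => by
      obtain ⟨hiv, him, hiS⟩ := hUmem.1 hi
      rw [hφ ((S.erase v).erase i) m (by simp [him.symm, hvm.symm, hm])
        fun x hx => hle x (Finset.mem_of_mem_erase (Finset.mem_of_mem_erase hx)), Finset.mul_sum,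
        Finset.erase_right_comm (a := i) (b := m), Finset.erase_right_comm (a := v) (b := m)]
      refine Finset.sum_congr rfl fun p _ => ?_
      rw [Finset.erase_right_comm (a := i) (b := p)]
      ring
    rw [Finset.sum_congr rfl h1, Finset.sum_congr rfl h2, sum_erase_comm]

end Hafnian

/-! ### Sums over sequences of index pairs. -/

section Sequences

variable {ι R : Type*} [LinearOrder ι] [Fintype ι] [Ring R]

open Classical in
lemma sum_sequences_eq_seqSum (r : ι → ι → R) (m : ℕ) (K S : Finset ι) :
    ∑ ab : (Fin m → ι) × (Fin m → ι) with (∀ i, ab.1 i ∈ S) ∧ (∀ i, ab.2 i ∈ K) ∧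
        Function.Injective ab.1 ∧ Monotone ab.2,
      (List.ofFn fun i => r (ab.1 i) (ab.2 i)).prod = seqSum r m K S := by
  induction m generalizing K S with
  | zero =>
    rw [Finset.filter_true_of_mem]
    · simp [seqSum]
    · intro ab _
      exact ⟨fun i => i.elim0, fun i => i.elim0, fun i => i.elim0, fun i => i.elim0⟩
  | succ m ih =>
    rw [seqSum, ← Finset.sum_product' (f := fun a b =>
      r a b * seqSum r m (K.filter (b ≤ ·)) (S.erase a))]
    simp only [← ih, Finset.mul_sum]
    rw [Finset.sum_sigma']
    refine Finset.sum_bij' (fun ab _ => ⟨(ab.1 0, ab.2 0), (Fin.tail ab.1, Fin.tail ab.2)⟩)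
      (fun x _ => (Fin.cons x.1.1 x.2.1, Fin.cons x.1.2 x.2.2)) ?_ ?_ ?_ ?_ ?_
    · rintro ⟨a, b⟩ hab
      simp only [Finset.mem_filter, Finset.mem_univ, true_and] at hab
      obtain ⟨haS, hbK, hinj, hmon⟩ := hab
      simp only [Finset.mem_sigma, Finset.mem_product, Finset.mem_filter, Finset.mem_univ,
        true_and, Finset.mem_erase, Fin.tail]
      refine ⟨⟨haS 0, hbK 0⟩, fun i => ⟨fun e => Fin.succ_ne_zero i (hinj e), haS _⟩,
        fun i => ⟨hbK _, hmon (Fin.zero_le _)⟩, fun i j e => Fin.succ_injective _ (hinj e),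
        fun i j e => hmon (Fin.succ_le_succ_iff.2 e)⟩
    · rintro ⟨⟨a₀, b₀⟩, a, b⟩ hx
      simp only [Finset.mem_sigma, Finset.mem_product, Finset.mem_filter, Finset.mem_univ,
        true_and, Finset.mem_erase] at hx
      obtain ⟨⟨ha₀, hb₀⟩, haS, hbK, hinj, hmon⟩ := hx
      simp only [Finset.mem_filter, Finset.mem_univ, true_and]
      refine ⟨fun i => ?_, fun i => ?_, ?_, fun i j hij => ?_⟩
      · refine Fin.cases ?_ (fun i => ?_) i
        · exact ha₀
        · exact (haS i).2
      · refine Fin.cases ?_ (fun i => ?_) i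
        · exact hb₀
        · exact (hbK i).1
      · rw [Fin.cons_injective_iff]
        exact ⟨fun ⟨i, hi⟩ => (haS i).1 hi, hinj⟩
      · revert hij
        refine Fin.cases (fun _ => ?_) (fun i => ?_) i
        · refine Fin.cases ?_ (fun j => ?_) j
          · exact le_rfl
          · exact (hbK j).2
        · refine Fin.cases (fun hij => ?_) (fun j hij => ?_) j
          · exact absurd hij (by simp)
          · exact hmon (Fin.succ_le_succ_iff.1 hij)
    · rintro ⟨a, b⟩ _
      simp [Fin.cons_self_tail]
    · rintro ⟨⟨a₀, b₀⟩, a, b⟩ _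
      simp [Fin.tail_cons]
    · rintro ⟨a, b⟩ _
      simp [List.ofFn_succ, Fin.tail]

end Sequences

/-! ### Matchings and identities of meromorphic functions. -/

section Mero

variable {n : ℕ}

/-- The hafnian of the functions `℘(x_i - x_j)`, `i, j ∈ S`. -/
noncomputable def hafMero (L : PeriodPair) (S : Finset (Fin n)) : Mero n :=
  if Even S.card then matchSum L (S.card / 2) S else 0

lemma diffMero_wp_symm (L : PeriodPair) (i j : Fin n) :
    diffMero (wp L) i j = diffMero (wp L) j i := by
  refine congrArg (Ideal.Quotient.mk _) (Subtype.ext (funext fun x => ?_))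
  change L.weierstrassP _ = L.weierstrassP _
  rw [← L.weierstrassP_neg, neg_sub]

/-- The least element of S can only be the first a, so removing the first pair leaves a matching of
the rest. -/
lemma matchSum_succ (L : PeriodPair) (l : ℕ) {S : Finset (Fin n)} (hS : S.card = 2 * (l + 1))
    {m : Fin n} (hm : m ∈ S) (hle : ∀ x ∈ S, m ≤ x) :
    matchSum L (l + 1) S =
      ∑ i ∈ S.erase m, diffMero (wp L) m i * matchSum L l ((S.erase m).erase i) := by
  classical
  have hmem : ∀ {k : ℕ} {T : Finset (Fin n)} {a b : Fin k → Fin n},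
      T = Finset.univ.image a ∪ Finset.univ.image b →
        (∀ i, a i ∈ T) ∧ (∀ i, b i ∈ T) ∧ ∀ x ∈ T, (∃ i, a i = x) ∨ ∃ i, b i = x := by
    rintro k T a b rfl
    refine ⟨fun i => ?_, fun i => ?_, fun x hx => ?_⟩
    · exact Finset.mem_union_left _ (Finset.mem_image_of_mem _ (Finset.mem_univ i))
    · exact Finset.mem_union_right _ (Finset.mem_image_of_mem _ (Finset.mem_univ i))
    · simpa using hx
  simp only [matchSum, Finset.mul_sum]
  rw [Finset.sum_sigma']
  refine Finset.sum_bij' (fun ab _ => ⟨ab.2 0, (Fin.tail ab.1, Fin.tail ab.2)⟩)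
    (fun x _ => (Fin.cons m x.2.1, Fin.cons x.1 x.2.2)) ?_ ?_ ?_ ?_ ?_
  all_goals
    have hzero : ∀ a b : Fin (l + 1) → Fin n, S = Finset.univ.image a ∪ Finset.univ.image b →
        StrictMono a → (∀ i, a i < b i) → a 0 = m := by
      intro a b hab ha hlt
      refine le_antisymm ?_ (hle _ ((hmem hab).1 0))
      rcases (hmem hab).2.2 m hm with ⟨i, hi⟩ | ⟨i, hi⟩
      · exact hi ▸ ha.monotone (Fin.zero_le i)
      · exact (ha.monotone (Fin.zero_le i)).trans ((hlt i).le.trans hi.le)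
  · rintro ⟨a, b⟩ hab
    simp only [Finset.mem_filter, Finset.mem_univ, true_and] at hab
    obtain ⟨hab, ha, hlt⟩ := hab
    obtain ⟨hm1, hm2, hm3⟩ := hmem hab
    have h0 := hzero a b hab ha hlt
    -- The 2(l + 1) entries cover a set of that size, so they are distinct.
    have hinj : Function.Injective (Sum.elim a b) := by
      rw [← Set.injOn_univ, ← Finset.coe_univ, ← Finset.card_image_iff]
      have : Finset.univ.image (Sum.elim a b) = S := by
        rw [hab]; ext x; simp
      rw [this, hS]
      simp
      ring
    have hbinj : ∀ {i j}, b i = b j → i = j := fun {i j} e =>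
      Sum.inr_injective (hinj (a₁ := Sum.inr i) (a₂ := Sum.inr j) e)
    have hab' : ∀ i j, a i ≠ b j := fun i j e =>
      Sum.inl_ne_inr (hinj (a₁ := Sum.inl i) (a₂ := Sum.inr j) e)
    simp only [Finset.mem_sigma, Finset.mem_filter, Finset.mem_univ, true_and, Finset.mem_erase]
    refine ⟨⟨fun e => hab' 0 0 (h0.trans e.symm), hm2 0⟩, ?_, fun i j hij =>
      ha (Fin.succ_lt_succ_iff.2 hij), fun i => hlt _⟩
    ext x
    simp only [Finset.mem_erase, Finset.mem_union, Finset.mem_image, Finset.mem_univ, true_and,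
      Fin.tail]
    constructor
    · rintro ⟨hx1, hx2, hx3⟩
      rcases hm3 x hx3 with ⟨i, rfl⟩ | ⟨i, rfl⟩
      · left
        refine ⟨i.pred fun e => hx2 (by rw [e, h0]), by simp⟩
      · right
        refine ⟨i.pred fun e => hx1 (by rw [e]), by simp⟩
    · rintro (⟨i, rfl⟩ | ⟨i, rfl⟩)
      · exact ⟨hab' _ _, fun e => Fin.succ_ne_zero i (ha.injective (e.trans h0.symm)), hm1 _⟩
      · exact ⟨fun e => Fin.succ_ne_zero i (hbinj e), fun e => hab' 0 i.succ (h0.trans e.symm),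
          hm2 _⟩
  · rintro ⟨i, a, b⟩ hx
    simp only [Finset.mem_sigma, Finset.mem_filter, Finset.mem_univ, true_and,
      Finset.mem_erase] at hx ⊢
    obtain ⟨⟨him, hiS⟩, hab, ha, hlt⟩ := hx
    obtain ⟨hm1, hm2, hm3⟩ := hmem hab
    refine ⟨?_, fun p q => ?_, fun p => ?_⟩
    · ext x
      have hx : x ∈ S ↔ x = m ∨ x = i ∨ x ∈ (S.erase m).erase i := by
        simp only [Finset.mem_erase]
        constructor
        · tauto
        · rintro (rfl | rfl | h)
          exacts [hm, hiS, h.2.2]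
      rw [hx, hab]
      simp only [Finset.mem_union, Finset.mem_image, Finset.mem_univ, true_and,
        Fin.exists_fin_succ, Fin.cons_zero, Fin.cons_succ]
      tauto
    · refine Fin.cases ?_ (fun p => ?_) p <;> refine Fin.cases ?_ (fun q => ?_) q
      · exact fun e => absurd e (lt_irrefl _)
      · intro _
        have := hm1 q
        simp only [Finset.mem_erase] at this
        exact lt_of_le_of_ne (hle _ this.2.2) this.2.1.symm
      · exact fun e => absurd e (by simp)
      · exact fun e => ha (Fin.succ_lt_succ_iff.1 e)
    · refine Fin.cases ?_ (fun p => ?_) p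
      · exact lt_of_le_of_ne (hle _ hiS) him.symm
      · exact hlt p
  · rintro ⟨a, b⟩ hab
    simp only [Finset.mem_filter, Finset.mem_univ, true_and] at hab
    simp [← hzero a b hab.1 hab.2.1 hab.2.2, Fin.cons_self_tail]
  · rintro ⟨i, a, b⟩ _
    simp [Fin.tail_cons]
  · rintro ⟨a, b⟩ hab
    simp only [Finset.mem_filter, Finset.mem_univ, true_and] at hab
    rw [Fin.prod_univ_succ]
    exact congrArg (fun k => diffMero (wp L) k (b 0) * _) (hzero a b hab.1 hab.2.1 hab.2.2)

lemma hafMero_expand (L : PeriodPair) (S : Finset (Fin n)) (v : Fin n) (hv : v ∈ S) :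
    hafMero L S = ∑ i ∈ S.erase v, diffMero (wp L) i v * hafMero L ((S.erase v).erase i) := by
  refine hafnian_expand (diffMero_wp_symm L) (fun S m hm hle => ?_) S v hv
  have hcard : ∀ i ∈ S.erase m, ((S.erase m).erase i).card + 2 = S.card := fun i hi => by
    have := Finset.card_erase_add_one hi
    have := Finset.card_erase_add_one hm
    omega
  by_cases hS : Even S.card
  · obtain ⟨l, hl⟩ : ∃ l, S.card = 2 * (l + 1) := by
      obtain ⟨l, hl⟩ := hS
      have := Finset.card_pos.2 ⟨m, hm⟩
      exact ⟨l - 1, by omega⟩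
    rw [hafMero, if_pos hS, show S.card / 2 = l + 1 by omega, matchSum_succ L l hl hm hle]
    refine Finset.sum_congr rfl fun i hi => ?_
    have hc : ((S.erase m).erase i).card = 2 * l := by have := hcard i hi; omega
    rw [hafMero, if_pos (by rw [hc]; exact even_two_mul l), hc, Nat.mul_div_cancel_left _ two_pos]
  · rw [hafMero, if_neg hS, Finset.sum_eq_zero fun i hi => ?_]
    rw [hafMero, if_neg, mul_zero]
    rw [← hcard i hi] at hS
    intro he
    exact hS (he.add even_two)

/-- The points of `ℂⁿ` with distinct `i`-th and `j`-th coordinates are dense. -/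
lemma dense_apply_ne {i j : Fin n} (hij : i ≠ j) : Dense {z : Fin n → ℂ | z i ≠ z j} := by
  let p : Submodule ℂ (Fin n → ℂ) :=
    LinearMap.ker (LinearMap.proj (R := ℂ) (φ := fun _ : Fin n => ℂ) i - LinearMap.proj j)
  have hp : {z : Fin n → ℂ | z i ≠ z j} = (p : Set (Fin n → ℂ))ᶜ := by
    ext z
    simp [p, sub_eq_zero]
  rw [hp, ← interior_eq_empty_iff_dense_compl]
  by_contra hne
  have htop := p.eq_top_of_nonempty_interior' (Set.nonempty_iff_ne_empty.2 hne)
  have h1 : (Pi.single i 1 : Fin n → ℂ) ∈ p := htop ▸ Submodule.mem_top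
  simp [p, Pi.single_eq_of_ne hij.symm] at h1

lemma isOpen_apply_ne (i j : Fin n) : IsOpen {z : Fin n → ℂ | z i ≠ z j} :=
  isOpen_ne_fun (continuous_apply i) (continuous_apply j)

lemma diffMero_ratPhi_triple (a : ℂ) {i j k : Fin n} (hij : i ≠ j) (hjk : j ≠ k) (hik : i ≠ k) :
    diffMero (ratPhi n a i j) i j * diffMero (ratPhi n a j k) j k +
      diffMero (ratPhi n a j k) j k * diffMero (ratPhi n a k i) k i +
      diffMero (ratPhi n a k i) k i * diffMero (ratPhi n a i j) i j = 0 := by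
  simp only [diffMero, ← map_mul, ← map_add]
  rw [Ideal.Quotient.eq_zero_iff_mem]
  -- The rational identity may fail on the diagonals, where division by zero gives 0; an open dense
  -- set suffices for equality in `Mero n`.
  have hd := ((dense_apply_ne hij).inter_of_isOpen_left (dense_apply_ne hjk)
    (isOpen_apply_ne i j)).inter_of_isOpen_left (dense_apply_ne hik)
    ((isOpen_apply_ne i j).inter (isOpen_apply_ne j k))
  refine hd.mono (interior_maximal ?_ (((isOpen_apply_ne i j).inter (isOpen_apply_ne j k)).inter
    (isOpen_apply_ne i k)))
  rintro z ⟨⟨h1, h2⟩, h3⟩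
  have e1 : z i - z j ≠ 0 := sub_ne_zero.2 h1
  have e2 : z j - z k ≠ 0 := sub_ne_zero.2 h2
  have e3 : z k - z i ≠ 0 := sub_ne_zero.2 (Ne.symm h3)
  change a / (z i - z j) * (a / (z j - z k)) + a / (z j - z k) * (a / (z k - z i)) +
    a / (z k - z i) * (a / (z i - z j)) = 0
  field_simp
  ring

lemma diffMero_ratPhi_skew (a : ℂ) (i j : Fin n) :
    diffMero (ratPhi n a j i) j i = -diffMero (ratPhi n a i j) i j := by
  rw [diffMero, diffMero, ← map_neg]
  refine congrArg (Ideal.Quotient.mk _) (Subtype.ext (funext fun z => ?_))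
  change a / (z j - z i) = -(a / (z i - z j))
  rw [← neg_sub, div_neg]

lemma diffMero_ellPsi (L : PeriodPair) (a : ℂ) (lam : Fin n → ℂ) (i j : Fin n) :
    diffMero (ellPsi L a lam i j) i j =
      diffMero (ratPhi n a i j) i j * diffMero (ratPhi n a i j) i j -
        (diffMero (wp L) i j - algebraMap ℂ (Mero n) (wpLam L lam i j)) := by
  have hA : algebraMap ℂ (Mero n) (wpLam L lam i j) =
      Ideal.Quotient.mk (meroNull n) (algebraMap ℂ (meroSub n) (wpLam L lam i j)) := rfl
  rw [hA, diffMero, diffMero, diffMero, ← map_mul, ← map_sub, ← map_sub]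
  refine congrArg (Ideal.Quotient.mk _) (Subtype.ext (funext fun z => ?_))
  change a ^ 2 / (z i - z j) ^ 2 - (L.weierstrassP (z i - z j) - wpLam L lam i j) =
    a / (z i - z j) * (a / (z i - z j)) - (L.weierstrassP (z i - z j) - wpLam L lam i j)
  rw [← div_pow, sq]

lemma permMero_diffMero (s : Equiv.Perm (Fin n)) (f : MeroOne) (i j : Fin n) :
    permMero s (diffMero f i j) = diffMero f (s i) (s j) := rfl

end Mero

/-! ### The brackets of the deformed Fomin–Kirillov algebra -/

section DeformedFK

variable {n : ℕ} (φ ψ : Fin n → Fin n → MeroOne)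

lemma sym_skew {i j : Fin n} (hij : i ≠ j) : sym φ ψ j i = -sym φ ψ i j := by
  rw [sym, RingQuot.mkAlgHom_rel ℂ (Rel.skew i j hij), map_neg, sym]

lemma sym_sq {i j : Fin n} (hij : i ≠ j) :
    sym φ ψ i j * sym φ ψ i j = ofMero φ ψ (diffMero (ψ i j) i j) := by
  rw [sym, ← map_mul, RingQuot.mkAlgHom_rel ℂ (Rel.square i j hij)]
  rfl

lemma sym_commute {i j k l : Fin n} (hij : i ≠ j) (hkl : k ≠ l) (hik : i ≠ k) (hil : i ≠ l)
    (hjk : j ≠ k) (hjl : j ≠ l) : Commute (sym φ ψ i j) (sym φ ψ k l) := by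
  rw [Commute, SemiconjBy, sym, sym, ← map_mul,
    RingQuot.mkAlgHom_rel ℂ (Rel.comm i j k l hij hkl hik hil hjk hjl), map_mul]

lemma sym_triple {i j k : Fin n} (hij : i ≠ j) (hjk : j ≠ k) (hik : i ≠ k) :
    sym φ ψ i j * sym φ ψ j k + sym φ ψ j k * sym φ ψ k i + sym φ ψ k i * sym φ ψ i j = 0 := by
  have := RingQuot.mkAlgHom_rel ℂ (Rel.triple (φ := φ) (ψ := ψ) i j k hij hjk hik)
  rwa [map_add, map_add, map_mul, map_mul, map_mul, map_zero] at this

lemma bracket_mul_ofMero {i j : Fin n} (hij : i ≠ j) (f : Mero n) :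
    bracket φ ψ i j * ofMero φ ψ f =
      ofMero φ ψ (permMero (Equiv.swap i j) f) * bracket φ ψ i j := by
  have := RingQuot.mkAlgHom_rel ℂ (Rel.cross (φ := φ) (ψ := ψ) i j f hij)
  rwa [map_mul, map_mul, map_sub] at this

end DeformedFK

section Elliptic

variable {n : ℕ} (L : PeriodPair) (a : ℂ) (lam : Fin n → ℂ)

/-- Subtracting from symbols `s i j` with `s i j ^ 2 = p i j ^ 2 - (w i j - c i j)` the elements
`p i j` for which `s i j - p i j` permutes the indices of `p` and of `w`. -/
lemma isBracket_sub {ι R : Type*} [LinearOrder ι] [Ring R] {s p c w : ι → ι → R}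
    (hskew : ∀ i j, i ≠ j → s j i = -s i j)
    (hcomm : ∀ i j k l, i ≠ j → k ≠ l → i ≠ k → i ≠ l → j ≠ k → j ≠ l → Commute (s i j) (s k l))
    (htriple : ∀ i j k, i ≠ j → j ≠ k → i ≠ k →
      s i j * s j k + s j k * s k i + s k i * s i j = 0)
    (hsq : ∀ i j, i ≠ j → s i j * s i j = p i j * p i j - (w i j - c i j))
    (hpskew : ∀ i j, p j i = -p i j) (hpcomm : ∀ i j k l, Commute (p i j) (p k l))
    (hptriple : ∀ i j k, i ≠ j → j ≠ k → i ≠ k →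
      p i j * p j k + p j k * p k i + p k i * p i j = 0)
    (hcross : ∀ i j k l, i ≠ j →
      (s i j - p i j) * p k l = p (Equiv.swap i j k) (Equiv.swap i j l) * (s i j - p i j))
    (hw : ∀ i j k l, i ≠ j →
      (s i j - p i j) * w k l = w (Equiv.swap i j k) (Equiv.swap i j l) * (s i j - p i j))
    (hc : ∀ i j x, Commute (c i j) x) : IsBracket (fun i j => s i j - p i j) c w := by
  refine ⟨fun i j hij => ?_, fun i j k l hij hkl hik hil hjk hjl => ?_,
    fun i j k hij hjk hik => ?_, fun i j hij => ?_, hc, hw⟩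
  · rw [hskew i j hij, hpskew i j]
    abel
  · have h1 : Commute (s i j - p i j) (p k l) := by
      have := hcross i j k l hij
      rwa [Equiv.swap_apply_of_ne_of_ne hik.symm hjk.symm,
        Equiv.swap_apply_of_ne_of_ne hil.symm hjl.symm] at this
    have h2 : Commute (s k l - p k l) (p i j) := by
      have := hcross k l i j hkl
      rwa [Equiv.swap_apply_of_ne_of_ne hik hil, Equiv.swap_apply_of_ne_of_ne hjk hjl] at this
    have h3 : Commute (s k l) (p i j) := by
      simpa using h2.add_left (hpcomm k l i j)
    exact ((hcomm i j k l hij hkl hik hil hjk hjl).sub_left h3.symm).sub_right h1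
  · have hcyc : ∀ i j k, i ≠ j → j ≠ k → i ≠ k →
        (s i j - p i j) * p j k = -(p k i * (s i j - p i j)) := fun i j k hij hjk hik => by
      rw [hcross i j j k hij, Equiv.swap_apply_right,
        Equiv.swap_apply_of_ne_of_ne hik.symm hjk.symm, hpskew k i, neg_mul]
    calc _ = s i j * s j k + s j k * s k i + s k i * s i j
          - (p i j * p j k + p j k * p k i + p k i * p i j)
          - ((s i j - p i j) * p j k + p k i * (s i j - p i j))
          - ((s j k - p j k) * p k i + p i j * (s j k - p j k))
          - ((s k i - p k i) * p i j + p j k * (s k i - p k i)) := by noncomm_ring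
      _ = 0 := by
        rw [htriple i j k hij hjk hik, hptriple i j k hij hjk hik, hcyc i j k hij hjk hik,
          hcyc j k i hjk hik.symm hij.symm, hcyc k i j hik.symm hij hjk.symm]
        simp
  · have h1 : (s i j - p i j) * p i j = -(p i j * (s i j - p i j)) := by
      rw [hcross i j i j hij, Equiv.swap_apply_left, Equiv.swap_apply_right, hpskew i j, neg_mul]
    calc _ = s i j * s i j - p i j * p i j
          - ((s i j - p i j) * p i j + p i j * (s i j - p i j)) := by noncomm_ring
      _ = c i j - w i j := by
        rw [hsq i j hij, h1]
        abel

lemma bracket_mul_diffMero {φ ψ : Fin n → Fin n → MeroOne} {i j : Fin n} (hij : i ≠ j)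
    (f : MeroOne) (k l : Fin n) :
    bracket φ ψ i j * ofMero φ ψ (diffMero f k l) =
      ofMero φ ψ (diffMero f (Equiv.swap i j k) (Equiv.swap i j l)) * bracket φ ψ i j := by
  rw [bracket_mul_ofMero φ ψ hij, permMero_diffMero]

lemma commute_ofMero {φ ψ : Fin n → Fin n → MeroOne} (f g : Mero n) :
    Commute (ofMero φ ψ f) (ofMero φ ψ g) := by
  have := congrArg (ofMero φ ψ) (mul_comm f g)
  rwa [map_mul, map_mul] at this

/-- The brackets of the elliptic Fomin–Kirillov algebra. -/
lemma isBracket_bracket :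
    IsBracket (bracket (ratPhi n a) (ellPsi L a lam))
      (fun i j => algebraMap ℂ (EllFK L a lam) (wpLam L lam i j))
      (fun i j => ofMero (ratPhi n a) (ellPsi L a lam) (diffMero (wp L) i j)) := by
  refine isBracket_sub (s := sym (ratPhi n a) (ellPsi L a lam))
    (p := fun i j => ofMero (ratPhi n a) (ellPsi L a lam) (diffMero (ratPhi n a i j) i j))
    (fun i j => sym_skew _ _) (fun i j k l => sym_commute _ _) (fun i j k => sym_triple _ _)
    (fun i j hij => ?_) (fun i j => ?_) (fun i j k l => commute_ofMero _ _)
    (fun i j k hij hjk hik => ?_) (fun i j k l hij => bracket_mul_diffMero hij (ratPhi n a k l) k l)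
    (fun i j k l hij => bracket_mul_diffMero hij (wp L) k l) (fun i j x => Algebra.commutes _ x)
  · refine (sym_sq _ _ hij).trans ?_
    rw [diffMero_ellPsi, map_sub, map_sub, map_mul, AlgHom.commutes]
  · have := congrArg (ofMero (ratPhi n a) (ellPsi L a lam)) (diffMero_ratPhi_skew a i j)
    rwa [map_neg] at this
  · have := congrArg (ofMero (ratPhi n a) (ellPsi L a lam)) (diffMero_ratPhi_triple a hij hjk hik)
    rwa [map_add, map_add, map_mul, map_mul, map_mul, map_zero] at this

end Elliptic

/-! ### Commutation of the Dunkl elements -/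

section Dunkl

variable {ι R : Type*} [LinearOrder ι] [Fintype ι] [Ring R] {r c w : ι → ι → R}

lemma IsBracket.commute_dunkl (h : IsBracket r c w) (i j : ι) :
    Commute (∑ k ∈ Finset.univ.erase i, r i k) (∑ k ∈ Finset.univ.erase j, r j k) := by
  rcases eq_or_ne i j with rfl | hij
  · exact Commute.refl _
  set U := (Finset.univ.erase i).erase j with hU
  have hUi : ∀ k ∈ U, k ≠ i := by simp +contextual [hU]
  have hUj : ∀ k ∈ U, k ≠ j := by simp +contextual [hU]
  have hi : ∑ k ∈ Finset.univ.erase i, r i k = r i j + ∑ k ∈ U, r i k :=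
    (Finset.add_sum_erase _ _ (by simp [hij.symm])).symm
  have hj : ∑ k ∈ Finset.univ.erase j, r j k = -r i j + ∑ k ∈ U, r j k := by
    rw [← h.skew i j hij, hU, Finset.erase_right_comm]
    exact (Finset.add_sum_erase _ _ (by simp [hij])).symm
  -- For each k the part of the commutator on the indices i, j, k is the difference of two triple
  -- relations; the other products commute.
  have hk : ∀ k ∈ U, r i k * ∑ l ∈ U, r j l + r i j * r j k + r i j * r i k =
      (∑ l ∈ U, r j l) * r i k + r i k * r i j + r j k * r i j := fun k hk => by
    rw [← Finset.add_sum_erase _ _ hk]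
    have hc : Commute (r i k) (∑ l ∈ U.erase k, r j l) := Commute.sum_right _ _ _ fun l hl => by
      have hl' := Finset.mem_erase.1 hl
      exact h.comm i k j l (hUi k hk).symm (hUj l hl'.2).symm hij (hUi l hl'.2).symm (hUj k hk)
        hl'.1.symm
    have e1 := h.triple i j k hij (hUj k hk).symm (hUi k hk).symm
    have e2 := h.triple i k j (hUi k hk).symm (hUj k hk) hij
    rw [h.skew i k (hUi k hk).symm] at e1
    rw [h.skew i j hij, h.skew j k (hUj k hk).symm] at e2
    have e3 : r i k * r j k + r i j * r j k + r i j * r i k =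
        r j k * r i k + r i k * r i j + r j k * r i j := by
      rw [← sub_eq_zero]
      calc _ = (r i j * r j k + r j k * -r i k + -r i k * r i j) -
          (r i k * -r j k + -r j k * -r i j + -r i j * r i k) := by noncomm_ring
        _ = 0 := by rw [e1, e2, sub_zero]
    rw [mul_add, add_mul, hc.eq]
    calc _ = (r i k * r j k + r i j * r j k + r i j * r i k) +
          (∑ l ∈ U.erase k, r j l) * r i k := by abel
      _ = _ := by rw [e3]; abel
  have hs := Finset.sum_congr rfl hk
  simp only [Finset.sum_add_distrib, ← Finset.sum_mul, ← Finset.mul_sum] at hs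
  rw [hi, hj, Commute, SemiconjBy]
  generalize ∑ k ∈ U, r i k = X at *
  generalize ∑ k ∈ U, r j k = Y at *
  rw [← sub_eq_zero]
  calc _ = (X * Y + r i j * Y + r i j * X) - (Y * X + X * r i j + Y * r i j) := by noncomm_ring
    _ = 0 := by rw [hs, sub_self]

end Dunkl

end EllipticFK

namespace EllipticFK

/-! ### The Pieri formula -/

/-- Commuting elements generate a commutative subalgebra, where ordinary evaluation is available. -/
lemma exists_algHom_mvPolynomial {ι 𝕜 A : Type*} [CommRing 𝕜] [Ring A] [Algebra 𝕜 A] (x : ι → A)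
    (hx : ∀ i j, Commute (x i) (x j)) :
    ∃ ev : MvPolynomial ι 𝕜 →ₐ[𝕜] A, ∀ i, ev (MvPolynomial.X i) = x i := by
  have hcomm : ∀ a ∈ Set.range x, ∀ b ∈ Set.range x, a * b = b * a := by
    rintro _ ⟨i, rfl⟩ _ ⟨j, rfl⟩
    exact hx i j
  have := Algebra.isMulCommutative_adjoin 𝕜 hcomm
  let : CommSemiring (Algebra.adjoin 𝕜 (Set.range x)) := IsMulCommutative.instCommSemiring
  refine ⟨(Algebra.adjoin 𝕜 (Set.range x)).val.comp (MvPolynomial.aeval fun i =>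
    (⟨x i, Algebra.subset_adjoin ⟨i, rfl⟩⟩ : Algebra.adjoin 𝕜 (Set.range x))), fun i => ?_⟩
  rw [AlgHom.comp_apply, MvPolynomial.aeval_X]
  rfl

lemma sum_range_eq_sum_even {M : Type*} [AddCommMonoid M] (k : ℕ) {f : ℕ → M}
    (hf : ∀ t, ¬Even t → f t = 0) :
    ∑ t ∈ Finset.range (k + 1), f t = ∑ l ∈ Finset.range (k / 2 + 1), f (2 * l) := by
  rw [← Finset.sum_image (g := fun l => 2 * l) (fun _ _ _ _ h => by simpa using h)]
  symm
  refine Finset.sum_subset (fun t ht => ?_) fun t ht hne => hf t fun he => hne ?_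
  · obtain ⟨l, hl, rfl⟩ := Finset.mem_image.1 ht
    simp only [Finset.mem_range] at hl ⊢
    omega
  · obtain ⟨l, rfl⟩ := he
    simp only [Finset.mem_image, Finset.mem_range] at ht ⊢
    exact ⟨l, by omega, by omega⟩

/-- A pair T ⊆ W is recorded as T and W \ T, sorted by the size of T. -/
lemma pieriRHS_eq_sum {ι R : Type*} [LinearOrder ι] [Fintype ι] [Ring R] (r : ι → ι → R)
    (φ : Finset ι → R) (k : ℕ) (I : Finset ι) :
    pieriRHS r φ k I = ∑ t ∈ Finset.range (k + 1), ∑ T ∈ I.powersetCard t,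
      φ T * seqSum r (k - t) Iᶜ (I \ T) := by
  simp only [pieriRHS, setConv, seqSum_eq_sum_fullSum, Finset.mul_sum]
  simp only [Finset.sum_sigma']
  refine Finset.sum_bij' (fun x _ => ⟨x.2.card, x.2, x.1 \ x.2⟩)
    (fun x _ => ⟨x.2.1 ∪ x.2.2, x.2.1⟩) ?_ ?_ ?_ ?_ ?_
  · rintro ⟨W, T⟩ hx
    simp only [Finset.mem_sigma, Finset.mem_powersetCard, Finset.mem_powerset,
      Finset.mem_range] at hx ⊢
    obtain ⟨⟨hWI, hW⟩, hTW⟩ := hx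
    have := Finset.card_le_card hTW
    exact ⟨by omega, ⟨hTW.trans hWI, trivial⟩, Finset.sdiff_subset_sdiff hWI subset_rfl, by
      rw [Finset.card_sdiff_of_subset hTW, hW]⟩
  · rintro ⟨t, T, S⟩ hx
    simp only [Finset.mem_sigma, Finset.mem_powersetCard, Finset.mem_powerset,
      Finset.mem_range] at hx ⊢
    obtain ⟨ht, ⟨hTI, hT⟩, hSI, hS⟩ := hx
    have hd : Disjoint T S := Finset.disjoint_of_subset_right hSI Finset.disjoint_sdiff
    refine ⟨⟨Finset.union_subset hTI (hSI.trans Finset.sdiff_subset), ?_⟩,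
      Finset.subset_union_left⟩
    rw [Finset.card_union_of_disjoint hd]
    omega
  · rintro ⟨W, T⟩ hx
    simp only [Finset.mem_sigma, Finset.mem_powerset] at hx
    simp [Finset.union_sdiff_of_subset hx.2]
  · rintro ⟨t, T, S⟩ hx
    simp only [Finset.mem_sigma, Finset.mem_powersetCard] at hx
    obtain ⟨ht, ⟨hTI, hT⟩, hSI, hS⟩ := hx
    have hd : Disjoint T S := Finset.disjoint_of_subset_right hSI Finset.disjoint_sdiff
    simp [Finset.union_sdiff_cancel_left hd, hT]
  · intros
    rfl

/-! ### Evaluation of the deformed elementary polynomials. -/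

section Elliptic

variable {n : ℕ} (L : PeriodPair) (a : ℂ) (lam : Fin n → ℂ)

lemma pieriSum_eq_seqSum (φ ψ : Fin n → Fin n → MeroOne) (m : ℕ) (S I : Finset (Fin n)) :
    pieriSum φ ψ m S I = seqSum (bracket φ ψ) m Iᶜ S := by
  rw [← sum_sequences_eq_seqSum, pieriSum]
  simp only [Finset.mem_compl]

lemma hafMero_empty : hafMero L (∅ : Finset (Fin n)) = 1 := by
  classical
  rw [hafMero, if_pos (by simp), Finset.card_empty, Nat.zero_div, matchSum,
    Finset.filter_true_of_mem]
  · simp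
  · intro ab _
    exact ⟨by simp, fun i => i.elim0, fun i => i.elim0⟩

lemma pieriRHS_bracket (k : ℕ) (I : Finset (Fin n)) :
    pieriRHS (bracket (ratPhi n a) (ellPsi L a lam))
        (fun S => ofMero (ratPhi n a) (ellPsi L a lam) (hafMero L S)) k I =
      ∑ l ∈ Finset.range (k / 2 + 1), ∑ I₀ ∈ I.powersetCard (2 * l),
        ofMero (ratPhi n a) (ellPsi L a lam) (matchSum L l I₀) *
          pieriSum (ratPhi n a) (ellPsi L a lam) (k - 2 * l) (I \ I₀) I := by
  rw [pieriRHS_eq_sum, sum_range_eq_sum_even k]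
  · refine Finset.sum_congr rfl fun l _ => Finset.sum_congr rfl fun T hT => ?_
    have hc := (Finset.mem_powersetCard.1 hT).2
    rw [pieriSum_eq_seqSum, hafMero, hc, if_pos (even_two_mul l), Nat.mul_div_cancel_left _ two_pos]
  · intro t ht
    refine Finset.sum_eq_zero fun T hT => ?_
    have hc := (Finset.mem_powersetCard.1 hT).2
    rw [hafMero, hc, if_neg ht, map_zero]
    exact zero_mul _

lemma map_defElem (ev : MvPolynomial (Fin n) ℂ →ₐ[ℂ] EllFK L a lam)
    (hev : ∀ i, ev (MvPolynomial.X i) = dunkl (ratPhi n a) (ellPsi L a lam) i)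
    (k : ℕ) (I : Finset (Fin n)) :
    ev (defElem (wpLam L lam) k I) = pieriRHS (bracket (ratPhi n a) (ellPsi L a lam))
      (fun S => ofMero (ratPhi n a) (ellPsi L a lam) (hafMero L S)) k I := by
  induction I using Finset.strongInduction generalizing k with
  | H I ih =>
    cases k with
    | zero =>
      rw [defElem_zero, map_one, pieriRHS, Finset.powersetCard_zero, Finset.sum_singleton,
        setConv_empty, hafMero_empty, map_one, fullSum_empty]
      exact (one_mul _).symm
    | succ k =>
      rcases I.eq_empty_or_nonempty with rfl | ⟨j, hjI⟩
      · rw [defElem_succ_empty, map_zero, pieriRHS, Finset.powersetCard_eq_empty.2 (by simp),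
          Finset.sum_empty]
      obtain ⟨I, hj, rfl⟩ : ∃ J, j ∉ J ∧ I = insert j J :=
        ⟨I.erase j, Finset.notMem_erase j I, (Finset.insert_erase hjI).symm⟩
      have hs := Finset.ssubset_insert hj
      have hrec := (isBracket_bracket L a lam).pieriRHS_insert
        (φ := fun S => ofMero (ratPhi n a) (ellPsi L a lam) (hafMero L S))
        (fun S v hv => by
          have := congrArg (ofMero (ratPhi n a) (ellPsi L a lam)) (hafMero_expand L S v hv)
          rw [map_sum] at this
          refine this.trans (Finset.sum_congr rfl fun i _ => map_mul _ _ _))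
        (fun S i j => commute_ofMero _ _) k hj
      rw [hrec, defElem_insert_aux _ (wpLam_symm L lam) _ k I j le_rfl hj, map_add, map_add,
        map_mul, hev, ih I hs, ih I hs, map_sum]
      congr 1
      refine Finset.sum_congr rfl fun i hi => ?_
      rw [map_mul, ← MvPolynomial.algebraMap_eq, ev.commutes]
      congr 1
      -- Both conventions for E_{-1}, `defElemPred` and the `if`, give zero.
      cases k with
      | zero => exact map_zero ev
      | succ k => exact ih _ ((Finset.erase_ssubset hi).trans hs) k

end Elliptic

end EllipticFK

/-- The Dunkl elements commute, so that polynomials can be evaluated at them (`ev`); the value of the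
deformed elementary symmetric polynomial `E_k(I)` is given by the elliptic Pieri formula. -/
theorem theorem3p1 (n : ℕ) (L : PeriodPair) (a : ℂ) (lam : Fin n → ℂ)
    (hlam : ∀ i j, i ≠ j → lam i - lam j ∉ L.lattice) :
    ∃ ev : MvPolynomial (Fin n) ℂ →ₐ[ℂ] EllipticFK.EllFK L a lam,
      (∀ i, ev (MvPolynomial.X i) =
        EllipticFK.dunkl (EllipticFK.ratPhi n a) (EllipticFK.ellPsi L a lam) i) ∧
      ∀ (k : ℕ) (I : Finset (Fin n)),
        ev (EllipticFK.defElem (EllipticFK.wpLam L lam) k I) =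
          ∑ l ∈ Finset.range (k / 2 + 1), ∑ I₀ ∈ I.powersetCard (2 * l),
            EllipticFK.ofMero (EllipticFK.ratPhi n a) (EllipticFK.ellPsi L a lam)
                (EllipticFK.matchSum L l I₀) *
              EllipticFK.pieriSum (EllipticFK.ratPhi n a) (EllipticFK.ellPsi L a lam)
                (k - 2 * l) (I \ I₀) I := by
  obtain ⟨ev, hev⟩ := EllipticFK.exists_algHom_mvPolynomial (𝕜 := ℂ)
    (EllipticFK.dunkl (EllipticFK.ratPhi n a) (EllipticFK.ellPsi L a lam))
    (EllipticFK.isBracket_bracket L a lam).commute_dunkl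
  refine ⟨ev, hev, fun k I => ?_⟩
  rw [← EllipticFK.pieriRHS_bracket]
  exact EllipticFK.map_defElem L a lam ev hev k I
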